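/- **Setting.** Let $\Omega\subset\mathbb R^3$ be an open set and let $M\in L^2(\Omega)^3$. The space $W^1_0(\mathbb R^3)$ consists of the real functions $v$ with $(1+|x|^2)^{-1/2}v\in L^2(\mathbb R^3)$ and weak gradient $\nabla v\in L^2(\mathbb R^3)^3$; it carries the inner product $((v,w))=\int_{\mathbb R^3}\nabla v\cdot\nabla w\,dx$. For integers $0\le \ell\le k$ and $-\ell\le m\le \ell$ put $\alpha=(k,\ell,m)$; $\Lambda_k$ is the set of all such $\alpha$ with given $k$. At the point $\xi=(\sin\theta\cos\phi\sin\chi,\ \sin\theta\sin\phi\sin\chi,\ \cos\theta\sin\chi,\ \cos\chi)$ of the unit sphere $\mathbb S^3\subset\mathbb R^4$ let $$\mathscr Y_\alpha(\xi)=\frac{1}{\sqrt{a_{k,\ell}}}(\sin\chi)^\ell\,T_{k+1}^{(\ell+1)}(\cos\chi)\,Y_{\ell,m}(\phi,\theta),\qquad a_{k,\ell}=\frac{(k+1)\pi}{2}\,\frac{(k+\ell+1)!}{(k-\ell)!},$$ where $T_{k+1}^{(\ell+1)}$ is the $(\ell+1)$-th derivative of the Chebyshev polynomial of the first kind $T_{k+1}$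 and $$Y_{\ell,m}(\phi,\theta)=\sqrt{\tfrac{2\ell+1}{2\pi}}\;K_\ell^{|m|}(\cos\theta)\,y_m(\phi),\qquad K_\ell^{m}(t)=(-1)^m\sqrt{\tfrac{(\ell-m)!}{(\ell+m)!}}\;P_\ell^m(t)\quad(0\le m\le\ell),$$ $$P_\ell^m(t)=\frac{(-1)^m}{2^\ell\,\ell!}(1-t^2)^{m/2}\frac{d^{\ell+m}}{dt^{\ell+m}}(t^2-1)^\ell,$$ with $y_m(\phi)=\cos(m\phi)$ for $m\ge1$, $y_0=1/\sqrt2$, and $y_m(\phi)=\sin(|m|\phi)$ for $m\le-1$. The Arar–Boulmezaoud functions are $$\mathscr W_\alpha(x)=\Big(\frac{2}{|x|^2+1}\Big)^{1/2}\mathscr Y_\alpha(\pi^{-1}(x)),\qquad \pi^{-1}(x)=\Big(\frac{2x_1}{|x|^2+1},\frac{2x_2}{|x|^2+1},\frac{2x_3}{|x|^2+1},\frac{|x|^2-1}{|x|^2+1}\Big),\quad x\in\mathbb R^3.$$ For $N\ge0$ let $H_N$ be the space of functions $v(x)=\sum_{k=0}^N p_k(x)/(|x|^2+1)^{k+1/2}$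 on $\mathbb R^3$, where each $p_k$ is a real polynomial of degree at most $k$, and put $$U_N=\sum_{k=0}^N\sum_{\alpha\in\Lambda_k}\frac{4}{(2k+1)(2k+3)}\Big(\int_\Omega M\cdot\nabla\mathscr W_\alpha\,dx\Big)\mathscr W_\alpha .$$ **Proposition.** Let $N\ge 0$. The functions of $H_N$ are smooth, and $H_N\subset W^1_0(\mathbb R^3)$. Moreover: 1. The discrete problem: find $u\in H_N$ such that $$\int_{\mathbb R^3}\nabla u\cdot\nabla v\,dx=\int_\Omega M\cdot\nabla v\,dx\qquad\text{for all } v\in H_N$$ is well posed, and $U_N$ is its unique solution: $U_N$ is a solution, it is the only one, and $\int_{\mathbb R^3}|\nabla U_N|^2\,dx\le\int_\Omega|M|^2\,dx$. 2. Let $U\in W^1_0(\mathbb R^3)$ be the solution of $\Delta U=\operatorname{div}(M\chi_\Omega)$ in the sense of distributions on $\mathbb R^3$. Then $U_N$ is the orthogonal projection of $U$ on $H_N$ for the inner product $((\cdot,\cdot))$: it is the unique element $P\in H_N$ with $((U-P,v))=0$ for all $v\in H_N$. -/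

import Mathlib

open MeasureTheory
open scoped Gradient ContDiff Laplacian

noncomputable section

/-- Three-dimensional Euclidean space `ℝ³`. -/
abbrev E3 : Type := EuclideanSpace ℝ (Fin 3)

/-- Four-dimensional Euclidean space `ℝ⁴`, which contains the sphere `𝕊³`. -/
abbrev E4 : Type := EuclideanSpace ℝ (Fin 4)

/-! ### Spherical harmonics on `𝕊²` and on `𝕊³` -/

/-- The associated Legendre function
`P_ℓ^m (t) = (-1)^m / (2^ℓ ℓ!) (1 - t²)^{m/2} (d/dt)^{ℓ+m} (t² - 1)^ℓ`, for `0 ≤ m` and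
`t ∈ [-1, 1]`. -/
def assocLegendre (l m : ℕ) (t : ℝ) : ℝ :=
  (-1) ^ m / (2 ^ l * (l.factorial : ℝ)) * (1 - t ^ 2) ^ ((m : ℝ) / 2) *
    (Polynomial.derivative^[l + m]
      ((Polynomial.X ^ 2 - 1) ^ l : Polynomial ℝ)).eval t

/-- `K_ℓ^m (t) = (-1)^m √((ℓ-m)! / (ℓ+m)!) P_ℓ^m (t)` for `0 ≤ m ≤ ℓ`. -/
def legendreK (l m : ℕ) (t : ℝ) : ℝ :=
  (-1) ^ m * √(((l - m).factorial : ℝ) / ((l + m).factorial : ℝ)) * assocLegendre l m t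

/-- `y_m(φ) = cos(mφ)` for `m ≥ 1`, `1/√2` for `m = 0`, `sin(|m|φ)` for `m ≤ -1`. -/
def azimuthal (m : ℤ) (φ : ℝ) : ℝ :=
  if 1 ≤ m then Real.cos ((m : ℝ) * φ)
  else if m = 0 then 1 / √2
  else Real.sin (|(m : ℝ)| * φ)

/-- The usual real spherical harmonics on `𝕊²`:
`Y_{ℓ,m}(φ, θ) = √((2ℓ+1)/(2π)) K_ℓ^{|m|}(cos θ) y_m(φ)`. -/
def sphericalY (l : ℕ) (m : ℤ) (φ θ : ℝ) : ℝ :=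
  √((2 * (l : ℝ) + 1) / (2 * Real.pi)) * legendreK l m.natAbs (Real.cos θ) * azimuthal m φ

/-- The normalization constant `a_{k,ℓ} = ((k+1)π/2) (k+ℓ+1)! / (k-ℓ)!`, for `ℓ ≤ k`. -/
def normConst (k l : ℕ) : ℝ :=
  ((k : ℝ) + 1) * Real.pi / 2 * (((k + l + 1).factorial : ℝ) / ((k - l).factorial : ℝ))

/-- The spherical harmonic on `𝕊³` of index `α = (k, ℓ, m)` in the spherical coordinates
`(φ, θ, χ)`: `a_{k,ℓ}^{-1/2} (sin χ)^ℓ T_{k+1}^{(ℓ+1)}(cos χ) Y_{ℓ,m}(φ, θ)`, where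
`T_{k+1}^{(ℓ+1)}` is the `(ℓ+1)`-th derivative of the Chebyshev polynomial of the first kind. -/
def harmonicCoord (α : ℕ × ℕ × ℤ) (φ θ χ : ℝ) : ℝ :=
  1 / √(normConst α.1 α.2.1) * Real.sin χ ^ α.2.1 *
    (Polynomial.derivative^[α.2.1 + 1]
      (Polynomial.Chebyshev.T ℝ ((α.1 : ℤ) + 1))).eval (Real.cos χ) *
    sphericalY α.2.1 α.2.2 φ θ

/-- The angle `χ ∈ [0, π]` of a point of `𝕊³`, where
`ξ = (sin θ cos φ sin χ, sin θ sin φ sin χ, cos θ sin χ, cos χ)`. -/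
def angleChi (ξ : E4) : ℝ := Real.arccos (ξ 3)

/-- The angle `θ ∈ [0, π]` of a point of `𝕊³`. Where `sin χ = 0` it is arbitrary. -/
def angleTheta (ξ : E4) : ℝ := Real.arccos (ξ 2 / Real.sin (angleChi ξ))

/-- The angle `φ` of a point of `𝕊³`, determined modulo `2π` and taken in `(-π, π]`
(harmonics are `2π`-periodic in `φ`). Where `ξ₁ = ξ₂ = 0` it is arbitrary. -/
def anglePhi (ξ : E4) : ℝ := Complex.arg ⟨ξ 0, ξ 1⟩

/-- The spherical harmonic `𝒴_α` as a function of the point `ξ ∈ 𝕊³`. -/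
def harmonicS3 (α : ℕ × ℕ × ℤ) (ξ : E4) : ℝ :=
  harmonicCoord α (anglePhi ξ) (angleTheta ξ) (angleChi ξ)

/-! ### Arar-Boulmezaoud functions -/

/-- The inverse of the stereographic projection from the pole `(0, 0, 0, 1)` of `𝕊³`. -/
def invStereo (x : E3) : E4 :=
  !₂[2 * x 0 / (‖x‖ ^ 2 + 1), 2 * x 1 / (‖x‖ ^ 2 + 1), 2 * x 2 / (‖x‖ ^ 2 + 1),
    (‖x‖ ^ 2 - 1) / (‖x‖ ^ 2 + 1)]

/-- The Arar-Boulmezaoud function `𝒲_α(x) = (2 / (|x|² + 1))^{1/2} 𝒴_α(π⁻¹(x))`. -/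
def ararBoul (α : ℕ × ℕ × ℤ) (x : E3) : ℝ :=
  √(2 / (‖x‖ ^ 2 + 1)) * harmonicS3 α (invStereo x)

/-- The set `Λ_k` of the indices `(k, ℓ, m)` with `0 ≤ ℓ ≤ k` and `-ℓ ≤ m ≤ ℓ`. -/
def indexLevel (k : ℕ) : Finset (ℕ × ℕ × ℤ) :=
  ({k} ×ˢ Finset.range (k + 1) ×ˢ Finset.Icc (-(k : ℤ)) k).filter
    fun α => -(α.2.1 : ℤ) ≤ α.2.2 ∧ α.2.2 ≤ (α.2.1 : ℤ)

theorem mem_indexLevel (k i l : ℕ) (m : ℤ) :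
    (i, l, m) ∈ indexLevel k ↔ i = k ∧ l ≤ i ∧ -(l : ℤ) ≤ m ∧ m ≤ (l : ℤ) := by
  simp only [indexLevel, Finset.mem_filter, Finset.mem_product, Finset.mem_singleton,
    Finset.mem_range, Finset.mem_Icc]
  omega

/-! ### The spaces `H_N` -/

/-- The space `H_N` of the functions `x ↦ ∑_{k=0}^N p_k(x) / (|x|² + 1)^{k+1/2}` on `ℝ³`, where
`p_k` is a polynomial of degree at most `k`. -/
def spaceH (N : ℕ) : Submodule ℝ (E3 → ℝ) where
  carrier := {v | ∃ p : ℕ → MvPolynomial (Fin 3) ℝ, (∀ k ≤ N, (p k).totalDegree ≤ k) ∧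
    ∀ x : E3, v x = ∑ k ∈ Finset.range (N + 1),
      MvPolynomial.eval (fun i => x i) (p k) / (‖x‖ ^ 2 + 1) ^ ((k : ℝ) + 1 / 2)}
  add_mem' := by
    rintro v w ⟨p, hp, hv⟩ ⟨q, hq, hw⟩
    refine ⟨fun k => p k + q k, fun k hk => (MvPolynomial.totalDegree_add _ _).trans
      (max_le (hp k hk) (hq k hk)), fun x => ?_⟩
    simp [hv, hw, add_div, Finset.sum_add_distrib]
  zero_mem' := ⟨fun _ => 0, by simp, by simp⟩
  smul_mem' := by
    rintro c v ⟨p, hp, hv⟩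
    refine ⟨fun k => c • p k, fun k hk => (MvPolynomial.totalDegree_smul_le _ _).trans (hp k hk),
      fun x => ?_⟩
    simp [hv, MvPolynomial.smul_eval, Finset.mul_sum, mul_div_assoc]

/-! ### The weighted Sobolev space `W¹₀(ℝ³)` -/

/-- `G` is the weak (distributional) gradient of `v` on `ℝ³`. -/
def HasWeakGradient (v : E3 → ℝ) (G : E3 → E3) : Prop :=
  LocallyIntegrable v ∧ LocallyIntegrable G ∧
    ∀ φ : E3 → ℝ, ContDiff ℝ ∞ φ → HasCompactSupport φ →
      ∫ x, v x • ∇ φ x = -∫ x, φ x • G x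

open Classical in
/-- The weak gradient of `v` (unique up to null sets), and `0` if there is none. -/
def weakGradient (v : E3 → ℝ) : E3 → E3 :=
  if h : ∃ G, HasWeakGradient v G then h.choose else 0

/-- `v ∈ W¹₀(ℝ³)`: both `(1 + |x|²)^{-1/2} v` and the weak gradient of `v` are in `L²(ℝ³)`. -/
def MemW10 (v : E3 → ℝ) : Prop :=
  MemLp (fun x => v x / √(1 + ‖x‖ ^ 2)) 2 ∧ ∃ G, HasWeakGradient v G ∧ MemLp G 2

/-- The inner product `((v, w)) = ∫ ∇v · ∇w` of `W¹₀(ℝ³)`. -/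
def innerW10 (v w : E3 → ℝ) : ℝ :=
  ∫ x, inner ℝ (weakGradient v x) (weakGradient w x)

/-- `P` is the orthogonal projection of `U` on the subspace `H`, for the inner product of
`W¹₀(ℝ³)`. -/
def IsW10Projection (H : Submodule ℝ (E3 → ℝ)) (U P : E3 → ℝ) : Prop :=
  P ∈ H ∧ ∀ v ∈ H, innerW10 (U - P) v = 0

/-! ### The magnetic potential and its approximation -/

/-- `U` is a solution in `W¹₀(ℝ³)` of `ΔU = div(M χ_Ω)` in the sense of distributions on `ℝ³`. -/
def IsMagneticPotential (Ω : Set E3) (M : E3 → E3) (U : E3 → ℝ) : Prop :=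
  MemW10 U ∧ ∀ φ : E3 → ℝ, ContDiff ℝ ∞ φ → HasCompactSupport φ →
    ∫ x, U x * Δ φ x = -∫ x in Ω, inner ℝ (M x) (∇ φ x)

/-- The truncated potential
`U_N = ∑_{k=0}^N ∑_{α ∈ Λ_k} 4 / ((2k+1)(2k+3)) (∫_Ω M · ∇𝒲_α) 𝒲_α`. -/
def truncatedU (Ω : Set E3) (M : E3 → E3) (N : ℕ) : E3 → ℝ := fun x =>
  ∑ k ∈ Finset.range (N + 1), ∑ α ∈ indexLevel k,
    4 / ((2 * (k : ℝ) + 1) * (2 * (k : ℝ) + 3)) *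
      (∫ y in Ω, inner ℝ (M y) (∇ (ararBoul α) y)) * ararBoul α x

/-- `u` solves the discrete problem: `u ∈ H_N` and `∫ ∇u · ∇v = ∫_Ω M · ∇v` for all
`v ∈ H_N`. -/
def SolvesDiscrete (Ω : Set E3) (M : E3 → E3) (N : ℕ) (u : E3 → ℝ) : Prop :=
  u ∈ spaceH N ∧ ∀ v ∈ spaceH N,
    ∫ x, inner ℝ (∇ u x) (∇ v x) = ∫ x in Ω, inner ℝ (M x) (∇ v x)

end

/-! ### Weighted monomials -/

/-! The proof diagonalizes the Dirichlet form on `spaceH N`. Write s = |x|² + 1. By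
`spaceH_eq_wmonoSpan`, the discrete space is spanned by the weighted monomials x^a s^{-(j+1/2)} with
|a| ≤ j ≤ N. On these spaces the operator L = -(s²/4) Δ is triangular: on level j it is λ_j =
(j+1/2)(j+3/2) plus terms of lower level (`exists_laplacian_eq`). Green's formula
(`integral_inner_gradient_eq`), obtained by cutting off at infinity, gives ∫ ∇u · ∇v = ⟨Lu, v⟩,
where ⟨·,·⟩ is the L² product with weight 4/s².

The functions `ararBoul` are orthonormal for ⟨·,·⟩ (`integral_ararBoul_mul`). Spherical coordinates
and r = cot(χ/2) split the integral into three one-dimensional ones: trigonometric in φ, Legendre in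
θ, derivatives of Chebyshev polynomials in χ. The last two follow from one Sturm-Liouville argument
for Gegenbauer equations. Rewriting the angular factors as solid harmonics shows that a function of
level k lies in `wmonoSpan (k + 1)` (`ararBoul_mem_wmonoSpan`). There are at least ∑ (k+1)² such
functions, and the space has at most that dimension, so they form a basis
(`exists_eq_sum_ararBoul`).

It is never checked directly that `ararBoul α` is an eigenfunction of L. If α has level at most that
of β, the lower order part of L 𝒲_α is a combination of levels below that of β, hence orthogonal to
𝒲_β. Thus the 𝒲_α are also orthogonal for the Dirichlet form, with squared norms λ_k
(`integral_inner_gradient_ararBoul`), and the Galerkin solution has coefficients (∫_Ω M · ∇𝒲_α)/λ_k.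
Since 1/λ_k = 4/((2k+1)(2k+3)), this is `truncatedU`.

For the projection, the equation for U, tested first with compactly supported functions and then by
density with `spaceH N`, says that ((U, v)) = ∫_Ω M · ∇v. Being the projection of U is therefore the
same as solving the discrete problem (`IsMagneticPotential.isW10Projection_iff`). -/

/-- The weighted monomial `x ↦ x^a (|x|² + 1)^{-b}`. -/
noncomputable def wmono (a : Fin 3 → ℕ) (b : ℝ) (x : E3) : ℝ :=
  (∏ i, x i ^ a i) * (‖x‖ ^ 2 + 1) ^ (-b)

/-- The `i`-th partial derivative of a function on `ℝ³`. -/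
noncomputable def pd (i : Fin 3) (f : E3 → ℝ) (x : E3) : ℝ :=
  fderiv ℝ f x (EuclideanSpace.single i 1)

theorem normSq_add_one_pos (x : E3) : 0 < ‖x‖ ^ 2 + 1 := by positivity

theorem contDiff_wmono (a : Fin 3 → ℕ) (b : ℝ) : ContDiff ℝ ∞ (wmono a b) := by
  unfold wmono
  refine ContDiff.mul (contDiff_prod fun i _ => ?_) ?_
  · fun_prop
  · exact ContDiff.rpow_const_of_ne ((contDiff_norm_sq ℝ).add contDiff_const) fun x =>
      (normSq_add_one_pos x).ne'

theorem hasFDerivAt_coord (i : Fin 3) (x : E3) :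
    HasFDerivAt (fun y : E3 => y i) (EuclideanSpace.proj i : E3 →L[ℝ] ℝ) x :=
  (EuclideanSpace.proj i : E3 →L[ℝ] ℝ).hasFDerivAt

theorem hasFDerivAt_weight (b : ℝ) (x : E3) :
    HasFDerivAt (fun y : E3 => (‖y‖ ^ 2 + 1) ^ (-b))
      ((-b * (‖x‖ ^ 2 + 1) ^ (-b - 1)) • (2 • innerSL ℝ x)) x :=
  ((hasStrictFDerivAt_norm_sq x).hasFDerivAt.add_const 1).rpow_const
    (Or.inl (normSq_add_one_pos x).ne')

theorem pd_wmono (i : Fin 3) (a : Fin 3 → ℕ) (b : ℝ) (x : E3) :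
    pd i (wmono a b) x = a i * wmono (Function.update a i (a i - 1)) b x -
      2 * b * wmono (Function.update a i (a i + 1)) (b + 1) x := by
  have h := (((((hasFDerivAt_coord 0 x).pow (a 0)).mul ((hasFDerivAt_coord 1 x).pow (a 1))).mul
    ((hasFDerivAt_coord 2 x).pow (a 2))).mul (hasFDerivAt_weight b x))
  have e : wmono a b = fun y : E3 => y 0 ^ a 0 * y 1 ^ a 1 * y 2 ^ a 2 * (‖y‖ ^ 2 + 1) ^ (-b) := by
    ext y; simp [wmono, Fin.prod_univ_three]
  have e2 : -(b + 1) = -b - 1 := by ring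
  rw [pd, e]
  erw [h.fderiv]
  fin_cases i <;> simp [wmono, Fin.prod_univ_three, e2,
    EuclideanSpace.inner_single_right] <;> ring

theorem pd_linear {f g : E3 → ℝ} {x : E3} (c d : ℝ) (i : Fin 3) (hf : DifferentiableAt ℝ f x)
    (hg : DifferentiableAt ℝ g x) :
    pd i (fun y => c * f y + d * g y) x = c * pd i f x + d * pd i g x := by
  simp [pd, fderiv_fun_add (hf.const_mul c) (hg.const_mul d), fderiv_const_mul hf,
    fderiv_const_mul hg]

theorem pd_pd_wmono (i : Fin 3) (a : Fin 3 → ℕ) (b : ℝ) (x : E3) :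
    pd i (pd i (wmono a b)) x = a i * (a i - 1) * wmono (Function.update a i (a i - 2)) b x -
      2 * b * (2 * a i + 1) * wmono a (b + 1) x +
      4 * b * (b + 1) * (x i ^ 2 * wmono a (b + 2) x) := by
  have hd : ∀ a b, DifferentiableAt ℝ (wmono a b) x := fun a b =>
    (contDiff_wmono a b).differentiable (by simp) x
  have e : pd i (wmono a b) = fun y => (a i : ℝ) * wmono (Function.update a i (a i - 1)) b y +
      (-(2 * b)) * wmono (Function.update a i (a i + 1)) (b + 1) y := by
    ext y; rw [pd_wmono]; ring
  -- Keeping x_i² as a separate factor lets the sum over i produce |x|².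
  have hsq : wmono (Function.update a i (a i + 2)) (b + 2) x = x i ^ 2 * wmono a (b + 2) x := by
    fin_cases i <;> simp [wmono, Fin.prod_univ_three] <;> ring
  rw [e, pd_linear _ _ i (hd _ _) (hd _ _), pd_wmono, pd_wmono]
  simp only [Function.update_self, Function.update_idem]
  have h1 : a i + 1 - 1 = a i := by omega
  rw [h1, Function.update_eq_self, show a i + 1 + 1 = a i + 2 by ring,
    show b + 1 + 1 = b + 2 by ring, hsq]
  rcases Nat.eq_zero_or_pos (a i) with h0 | h0
  · simp [h0]; ring
  · have h2 : a i - 1 + 1 = a i := by omega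
    rw [h2, Function.update_eq_self, show a i - 1 - 1 = a i - 2 by omega,
      Nat.cast_sub h0]
    push_cast; ring

theorem wmono_succ (a : Fin 3 → ℕ) (b : ℝ) (x : E3) :
    wmono a b x = (‖x‖ ^ 2 + 1) * wmono a (b + 1) x := by
  have h := normSq_add_one_pos x
  rw [wmono, wmono, show -b = 1 + -(b + 1) by ring, Real.rpow_add h, Real.rpow_one]
  ring

theorem sum_coord_sq (x : E3) : ∑ i, x i ^ 2 = ‖x‖ ^ 2 := by
  simp [EuclideanSpace.norm_sq_eq]

/-- Put in this form so that for b = j + 1/2 the middle coefficient is a multiple of |a| - j, which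
vanishes at top degree. This cancellation is what makes the operator triangular. -/
theorem sum_pd_pd_wmono (a : Fin 3 → ℕ) (b : ℝ) (x : E3) :
    ∑ i, pd i (pd i (wmono a b)) x = -(4 / (‖x‖ ^ 2 + 1) ^ 2) *
      (b * (b + 1) * wmono a b x + b * (∑ i, (a i : ℝ) + 1 / 2 - b) * wmono a (b - 1) x -
        1 / 4 * ∑ i, a i * (a i - 1 : ℝ) * wmono (Function.update a i (a i - 2)) (b - 2) x) := by
  have h := normSq_add_one_pos x
  have h2 : ∀ c, wmono c (b - 2) x = (‖x‖ ^ 2 + 1) ^ 2 * wmono c b x := fun c => by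
    rw [wmono_succ c (b - 2), wmono_succ c (b - 2 + 1), show b - 2 + 1 + 1 = b by ring]; ring
  have e1 : wmono a (b - 1) x = (‖x‖ ^ 2 + 1) ^ 3 * wmono a (b + 2) x := by
    rw [wmono_succ a (b - 1), wmono_succ a (b - 1 + 1), wmono_succ a (b - 1 + 1 + 1),
      show b - 1 + 1 + 1 + 1 = b + 2 by ring]; ring
  have e2 : wmono a b x = (‖x‖ ^ 2 + 1) ^ 2 * wmono a (b + 2) x := by
    rw [wmono_succ a b, wmono_succ a (b + 1), show b + 1 + 1 = b + 2 by ring]; ring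
  have e3 : wmono a (b + 1) x = (‖x‖ ^ 2 + 1) * wmono a (b + 2) x := by
    rw [wmono_succ a (b + 1), show b + 1 + 1 = b + 2 by ring]
  -- The undifferentiated monomials are expressed through exponent b + 2 and the lowered ones
  -- through exponent b; what remains is an identity of rational functions in |x|².
  simp only [pd_pd_wmono, h2]
  rw [e1, e2, e3]
  have hx := sum_coord_sq x
  simp only [Fin.sum_univ_three] at hx ⊢
  generalize wmono a (b + 2) x = w at *
  generalize ‖x‖ ^ 2 = r at *
  subst hx
  field_simp
  ring

/-- The span of the functions `x^a (|x|² + 1)^{-(j + 1/2)}` with `|a| ≤ j < n`. -/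
noncomputable def wmonoSpan (n : ℕ) : Submodule ℝ (E3 → ℝ) :=
  Submodule.span ℝ {f | ∃ (a : Fin 3 → ℕ) (j : ℕ), ∑ i, a i ≤ j ∧ j < n ∧
    f = wmono a ((j : ℝ) + 1 / 2)}

theorem wmono_mem_wmonoSpan {a : Fin 3 → ℕ} {j n : ℕ} (ha : ∑ i, a i ≤ j) (hj : j < n) {b : ℝ}
    (hb : b = (j : ℝ) + 1 / 2) : wmono a b ∈ wmonoSpan n :=
  Submodule.subset_span ⟨a, j, ha, hj, by rw [hb]⟩

theorem wmonoSpan_mono {m n : ℕ} (h : m ≤ n) : wmonoSpan m ≤ wmonoSpan n :=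
  Submodule.span_mono fun _ ⟨a, j, ha, hj, e⟩ => ⟨a, j, ha, hj.trans_le h, e⟩

theorem spaceH_eq_wmonoSpan (N : ℕ) : spaceH N = wmonoSpan (N + 1) := by
  apply le_antisymm
  · rintro v ⟨p, hp, hv⟩
    have e : v = ∑ k ∈ Finset.range (N + 1), ∑ d ∈ (p k).support,
        (p k).coeff d • wmono (⇑d) ((k : ℝ) + 1 / 2) := by
      ext x
      rw [hv, Finset.sum_apply]
      refine Finset.sum_congr rfl fun k _ => ?_
      rw [MvPolynomial.eval_eq', Finset.sum_apply, Finset.sum_div]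
      refine Finset.sum_congr rfl fun d _ => ?_
      rw [Pi.smul_apply, smul_eq_mul, wmono, Real.rpow_neg (normSq_add_one_pos x).le]
      ring
    rw [e]
    refine Submodule.sum_mem _ fun k hk => Submodule.sum_mem _ fun d hd => ?_
    have hk' := Finset.mem_range.1 hk
    refine Submodule.smul_mem _ _ (wmono_mem_wmonoSpan ?_ hk' rfl)
    have := MvPolynomial.le_totalDegree hd
    rw [Finsupp.sum_fintype _ _ fun _ => rfl] at this
    exact this.trans (hp k (by omega))
  · rw [wmonoSpan, Submodule.span_le]
    rintro _ ⟨a, j, ha, hj, rfl⟩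
    refine ⟨fun k => if k = j then MvPolynomial.monomial (Finsupp.equivFunOnFinite.symm a) 1
      else 0, fun k _ => ?_, fun x => ?_⟩
    · by_cases h : k = j
      · subst h
        simp only [if_true]
        rw [MvPolynomial.totalDegree_monomial _ one_ne_zero,
          Finsupp.sum_fintype _ _ fun _ => rfl]
        exact ha
      · simp [h]
    · rw [Finset.sum_eq_single_of_mem j (Finset.mem_range.2 hj) (fun k _ hk => by simp [hk])]
      simp only [if_true]
      rw [MvPolynomial.eval_monomial, Finsupp.prod_fintype _ _ fun _ => pow_zero _,
        wmono, Real.rpow_neg (normSq_add_one_pos x).le]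
      simp [div_eq_mul_inv]

/-! ### Smoothness and decay at infinity -/

theorem contDiff_of_mem_wmonoSpan {n : ℕ} {v : E3 → ℝ} (hv : v ∈ wmonoSpan n) :
    ContDiff ℝ ∞ v := by
  induction hv using Submodule.span_induction with
  | mem x h => obtain ⟨a, j, -, -, rfl⟩ := h; exact contDiff_wmono _ _
  | zero => exact contDiff_const
  | add x y _ _ hx hy => exact hx.add hy
  | smul c x _ hx => exact contDiff_const.mul hx

/-- Each coordinate satisfies |x_i| ≤ (|x|² + 1)^{1/2}. -/
theorem abs_wmono_le (a : Fin 3 → ℕ) (b : ℝ) (x : E3) :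
    |wmono a b x| ≤ (‖x‖ ^ 2 + 1) ^ ((∑ i, a i : ℕ) / 2 - b) := by
  have h := normSq_add_one_pos x
  rw [wmono, abs_mul, abs_of_pos (Real.rpow_pos_of_pos h _), sub_eq_add_neg, Real.rpow_add h]
  refine mul_le_mul_of_nonneg_right ?_ (Real.rpow_nonneg h.le _)
  have hs : (‖x‖ ^ 2 + 1) ^ (((∑ i, a i : ℕ) : ℝ) / 2) = ∏ i, √(‖x‖ ^ 2 + 1) ^ a i := by
    rw [Finset.prod_pow_eq_pow_sum, Real.sqrt_eq_rpow, ← Real.rpow_mul_natCast h.le]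
    congr 1; ring
  rw [hs, Finset.abs_prod]
  refine Finset.prod_le_prod (fun i _ => abs_nonneg _) fun i _ => ?_
  rw [abs_pow]
  refine pow_le_pow_left₀ (abs_nonneg _) ?_ _
  refine Real.abs_le_sqrt ?_
  have := Finset.single_le_sum (f := fun i => x i ^ 2) (fun i _ => sq_nonneg _)
    (Finset.mem_univ i)
  have h3 := sum_coord_sq x
  simp only at this
  linarith

theorem abs_wmono_le_of_le {a : Fin 3 → ℕ} {b c : ℝ} (h : ((∑ i, a i : ℕ) : ℝ) / 2 - b ≤ c)
    (x : E3) : |wmono a b x| ≤ (‖x‖ ^ 2 + 1) ^ c :=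
  (abs_wmono_le a b x).trans
    (Real.rpow_le_rpow_of_exponent_le (by linarith [sq_nonneg ‖x‖]) h)

/-- Differentiation gains half a power of |x|² + 1. The resulting rate (|x|² + 1)^{-1} is square
integrable on ℝ³. The constant is j from the monomial plus 2j + 1 from the weight. -/
theorem abs_pd_wmono_le {a : Fin 3 → ℕ} {j : ℕ} (ha : ∑ i, a i ≤ j) (i : Fin 3) (x : E3) :
    |pd i (wmono a ((j : ℝ) + 1 / 2)) x| ≤ (3 * j + 1) * (‖x‖ ^ 2 + 1) ^ (-1 : ℝ) := by
  have hs : ∀ m, ∑ k, Function.update a i m k + a i = ∑ k, a k + m := fun m => by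
    rw [Finset.sum_update_of_mem (Finset.mem_univ i), Finset.sdiff_singleton_eq_erase,
      ← Finset.add_sum_erase Finset.univ a (Finset.mem_univ i)]
    ring
  have hai : a i ≤ ∑ k, a k := Finset.single_le_sum (fun _ _ => Nat.zero_le _) (Finset.mem_univ i)
  have haj : (a i : ℝ) ≤ j := by exact_mod_cast hai.trans ha
  have hajj : ((∑ k, a k : ℕ) : ℝ) ≤ j := by exact_mod_cast ha
  have h1 : |(a i : ℝ) * wmono (Function.update a i (a i - 1)) ((j : ℝ) + 1 / 2) x| ≤
      j * (‖x‖ ^ 2 + 1) ^ (-1 : ℝ) := by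
    -- The exponent a_i - 1 is a truncated subtraction; when a_i = 0 the coefficient removes the
    -- term.
    rcases Nat.eq_zero_or_pos (a i) with h0 | h0
    · simp only [h0, Nat.cast_zero, zero_mul, abs_zero]
      have := normSq_add_one_pos x
      positivity
    · rw [abs_mul, Nat.abs_cast]
      refine mul_le_mul haj (abs_wmono_le_of_le ?_ x) (abs_nonneg _) (Nat.cast_nonneg _)
      have h3 : ∑ k, Function.update a i (a i - 1) k + 1 = ∑ k, a k := by
        have := hs (a i - 1); omega
      have h4 : ((∑ k, Function.update a i (a i - 1) k : ℕ) : ℝ) + 1 = (∑ k, a k : ℕ) := by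
        exact_mod_cast h3
      have h5 : (1 : ℝ) ≤ j := by exact_mod_cast (by omega : 1 ≤ j)
      linarith
  have h2 : |2 * ((j : ℝ) + 1 / 2) * wmono (Function.update a i (a i + 1))
      ((j : ℝ) + 1 / 2 + 1) x| ≤ (2 * j + 1) * (‖x‖ ^ 2 + 1) ^ (-1 : ℝ) := by
    rw [abs_mul, abs_of_nonneg (by positivity)]
    refine mul_le_mul (by linarith) (abs_wmono_le_of_le ?_ x) (abs_nonneg _) (by positivity)
    have h3 : ∑ k, Function.update a i (a i + 1) k = ∑ k, a k + 1 := by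
      have := hs (a i + 1); omega
    rw [h3]; push_cast at hajj ⊢
    have : (0 : ℝ) ≤ j := Nat.cast_nonneg _
    linarith
  rw [pd_wmono]
  refine (abs_sub _ _).trans ((add_le_add h1 h2).trans (le_of_eq (by ring)))

theorem abs_le_of_mem_wmonoSpan {n : ℕ} {v : E3 → ℝ} (hv : v ∈ wmonoSpan n) :
    ∃ C, 0 ≤ C ∧ ∀ x, |v x| ≤ C * (‖x‖ ^ 2 + 1) ^ (-(1 / 2) : ℝ) ∧
      ∀ i, |pd i v x| ≤ C * (‖x‖ ^ 2 + 1) ^ (-1 : ℝ) := by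
  induction hv using Submodule.span_induction with
  | mem x h =>
    obtain ⟨a, j, ha, -, rfl⟩ := h
    refine ⟨3 * j + 1, by positivity, fun x => ⟨?_, fun i => abs_pd_wmono_le ha i x⟩⟩
    have hajj : ((∑ k, a k : ℕ) : ℝ) ≤ j := by exact_mod_cast ha
    have h0 : (0 : ℝ) ≤ j := Nat.cast_nonneg _
    refine (abs_wmono_le_of_le (c := -(1 / 2)) (by linarith) x).trans ?_
    exact le_mul_of_one_le_left (Real.rpow_nonneg (normSq_add_one_pos x).le _) (by linarith)
  | zero => exact ⟨0, le_rfl, fun x => by simp [pd]⟩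
  | add u w hu hw hx hy =>
    obtain ⟨C, hC, h⟩ := hx
    obtain ⟨D, hD, h'⟩ := hy
    refine ⟨C + D, by positivity, fun x => ⟨?_, fun i => ?_⟩⟩
    · rw [add_mul]; exact (abs_add_le _ _).trans (add_le_add (h x).1 (h' x).1)
    · have : pd i (u + w) x = pd i u x + pd i w x := by
        rw [pd, fderiv_add ((contDiff_of_mem_wmonoSpan hu).differentiable (by simp) x)
          ((contDiff_of_mem_wmonoSpan hw).differentiable (by simp) x)]; rfl
      rw [add_mul, this]; exact (abs_add_le _ _).trans (add_le_add ((h x).2 i) ((h' x).2 i))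
  | smul c u hu hx =>
    obtain ⟨C, hC, h⟩ := hx
    refine ⟨|c| * C, by positivity, fun x => ⟨?_, fun i => ?_⟩⟩
    · rw [Pi.smul_apply, smul_eq_mul, abs_mul, mul_assoc]
      exact mul_le_mul_of_nonneg_left (h x).1 (abs_nonneg _)
    · have : pd i (c • u) x = c * pd i u x := by
        rw [pd, fderiv_const_smul ((contDiff_of_mem_wmonoSpan hu).differentiable (by simp) x)]; rfl
      rw [this, abs_mul, mul_assoc]
      exact mul_le_mul_of_nonneg_left ((h x).2 i) (abs_nonneg _)

/-! ### Triangularity of the Laplacian -/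

theorem contDiff_pd {f : E3 → ℝ} (hf : ContDiff ℝ ∞ f) (i : Fin 3) : ContDiff ℝ ∞ (pd i f) :=
  (hf.fderiv_right (m := ∞) (by simp)).clm_apply contDiff_const

/-- The operator `-(|x|² + 1)² / 4 Δ` is triangular on the spaces `wmonoSpan`. -/
theorem exists_laplacian_eq {n : ℕ} {u : E3 → ℝ} (hu : u ∈ wmonoSpan (n + 1)) :
    ∃ w : E3 → ℝ, w - (((n : ℝ) + 1 / 2) * (n + 3 / 2)) • u ∈ wmonoSpan n ∧
      ∀ x, ∑ i, pd i (pd i u) x = -(4 / (‖x‖ ^ 2 + 1) ^ 2) * w x := by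
  induction hu using Submodule.span_induction with
  | mem x h =>
    obtain ⟨a, j, ha, hj, rfl⟩ := h
    set b : ℝ := (j : ℝ) + 1 / 2 with hb
    set l : E3 → ℝ := (b * (∑ i, (a i : ℝ) + 1 / 2 - b)) • wmono a (b - 1) -
        (1 / 4 : ℝ) • ∑ i, (a i * (a i - 1 : ℝ)) • wmono (Function.update a i (a i - 2)) (b - 2)
      with hl
    have hlow : l ∈ wmonoSpan j := by
      refine Submodule.sub_mem _ ?_ (Submodule.smul_mem _ _ (Submodule.sum_mem _ fun i _ => ?_))
      -- If |a| = j the coefficient is zero; otherwise |a| ≤ j - 1, which is admissible for the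
      -- lowered weight.
      · rcases ha.eq_or_lt with h | h
        · have : (∑ i, (a i : ℝ)) = j := by exact_mod_cast h
          simp [this, hb]
        · refine Submodule.smul_mem _ _ (wmono_mem_wmonoSpan (j := j - 1) (by omega) (by omega) ?_)
          rw [Nat.cast_sub (by omega), hb]; push_cast; ring
      · by_cases h : 2 ≤ a i
        · have hai : a i ≤ ∑ k, a k :=
            Finset.single_le_sum (fun _ _ => Nat.zero_le _) (Finset.mem_univ i)
          refine Submodule.smul_mem _ _ (wmono_mem_wmonoSpan (j := j - 2) ?_ (by omega) ?_)
          · rw [Finset.sum_update_of_mem (Finset.mem_univ i), Finset.sdiff_singleton_eq_erase]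
            have := Finset.add_sum_erase Finset.univ a (Finset.mem_univ i)
            omega
          · rw [Nat.cast_sub (by omega), hb]; push_cast; ring
        · have : (a i : ℝ) * (a i - 1) = 0 := by
            have : a i = 0 ∨ a i = 1 := by omega
            rcases this with h | h <;> simp [h]
          simp [this]
    refine ⟨(b * (b + 1)) • wmono a b + l, ?_, fun x => ?_⟩
    -- On the top level j = n the multiple of u cancels the diagonal term; for j < n every term
    -- already lies in `wmonoSpan n`.
    · rcases (Nat.lt_succ_iff.1 hj).eq_or_lt with h | h
      · have : (((n : ℝ) + 1 / 2) * (n + 3 / 2)) = b * (b + 1) := by rw [hb, h]; ring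
        rw [this, add_sub_cancel_left, ← h]
        exact hlow
      · refine Submodule.sub_mem _ (Submodule.add_mem _ (Submodule.smul_mem _ _ ?_)
          (wmonoSpan_mono h.le hlow)) (Submodule.smul_mem _ _ ?_) <;>
        exact wmono_mem_wmonoSpan ha h hb
    · rw [sum_pd_pd_wmono]
      simp only [hl, Pi.add_apply, Pi.sub_apply, Pi.smul_apply, smul_eq_mul, Finset.sum_apply]
      ring
  | zero => exact ⟨0, by simp, fun x => by
      have : ∀ i, pd i (0 : E3 → ℝ) = 0 := fun i => by ext; simp [pd]
      simp [this]⟩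
  | add u w hu hw hx hy =>
    obtain ⟨w₁, h, h₁⟩ := hx
    obtain ⟨w₂, h', h₂⟩ := hy
    have cu := contDiff_of_mem_wmonoSpan hu
    have cw := contDiff_of_mem_wmonoSpan hw
    refine ⟨w₁ + w₂, ?_, fun x => ?_⟩
    · have := Submodule.add_mem _ h h'
      convert this using 1
      rw [smul_add]; abel
    · have : ∀ i, pd i (pd i (u + w)) x = pd i (pd i u) x + pd i (pd i w) x := fun i => by
        have : pd i (u + w) = pd i u + pd i w := by
          ext y
          rw [pd, fderiv_add (cu.differentiable (by simp) y) (cw.differentiable (by simp) y)]; rfl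
        rw [this, pd, fderiv_add ((contDiff_pd cu i).differentiable (by simp) x)
          ((contDiff_pd cw i).differentiable (by simp) x)]; rfl
      simp only [this, Finset.sum_add_distrib, h₁, h₂, Pi.add_apply]
      ring
  | smul c u hu hx =>
    obtain ⟨w₁, h, h₁⟩ := hx
    have cu := contDiff_of_mem_wmonoSpan hu
    refine ⟨c • w₁, ?_, fun x => ?_⟩
    · have := Submodule.smul_mem _ c h
      rwa [smul_sub, smul_comm] at this
    · have : ∀ i, pd i (pd i (c • u)) x = c * pd i (pd i u) x := fun i => by
        have : pd i (c • u) = c • pd i u := by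
          ext y
          rw [pd, fderiv_const_smul (cu.differentiable (by simp) y)]; rfl
        rw [this, pd, fderiv_const_smul ((contDiff_pd cu i).differentiable (by simp) x)]; rfl
      simp only [this, ← Finset.mul_sum, h₁, Pi.smul_apply, smul_eq_mul]
      ring

/-! ### Upper bound for the dimension -/

/-- The exponent attached to `(j, p, q)`: every exponent `a` with `|a| ≤ j` and `a₂ ≤ 1` is of
this form with `p, q ≤ j`. -/
def reducedExponent (i : Σ _ : ℕ, ℕ × ℕ) : Fin 3 → ℕ :=
  if i.2.1 + i.2.2 ≤ i.1 then ![i.2.1, i.2.2, 0] else ![i.1 - i.2.1, i.1 - i.2.2, 1]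

/-- The index set of a spanning family of `wmonoSpan n`. -/
def reducedIndex (n : ℕ) : Finset (Σ _ : ℕ, ℕ × ℕ) :=
  (Finset.range n).sigma fun j => Finset.range (j + 1) ×ˢ Finset.range (j + 1)

open Classical in
/-- A spanning family of `wmonoSpan n`. -/
noncomputable def reducedFamily (n : ℕ) : Finset (E3 → ℝ) :=
  (reducedIndex n).image fun i => wmono (reducedExponent i) ((i.1 : ℝ) + 1 / 2)

/-- For each j the square p, q ≤ j is cut into the triangle p + q ≤ j, which carries the exponents
with a₂ = 0, and its complement, which carries those with a₂ = 1 and |a| ≤ j. This is why (j+1)²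
monomials suffice. -/
theorem card_reducedIndex (n : ℕ) :
    (reducedIndex n).card = ∑ k ∈ Finset.range n, (k + 1) ^ 2 := by
  simp [reducedIndex, sq]

/-- Substitute x₃² = (|x|² + 1) - 1 - x₁² - x₂². When b = j + 1/2 and |a| ≤ j, all four terms remain
admissible, the first of them at level j - 1. -/
theorem wmono_reduce (a : Fin 3 → ℕ) (h : 2 ≤ a 2) (b : ℝ) :
    wmono a b = wmono ![a 0, a 1, a 2 - 2] (b - 1) - wmono ![a 0, a 1, a 2 - 2] b -
      wmono ![a 0 + 2, a 1, a 2 - 2] b - wmono ![a 0, a 1 + 2, a 2 - 2] b := by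
  ext x
  obtain ⟨c, hc⟩ := Nat.exists_eq_add_of_le h
  have hx := sum_coord_sq x
  simp only [Pi.sub_apply]
  rw [wmono_succ _ (b - 1), sub_add_cancel, ← hx]
  simp [wmono, Fin.prod_univ_three, Fin.sum_univ_three, hc]
  ring

theorem wmono_mem_span_reduced (n c : ℕ) : ∀ (a : Fin 3 → ℕ) (j : ℕ), a 2 = c → ∑ i, a i ≤ j →
    j < n → wmono a ((j : ℝ) + 1 / 2) ∈ Submodule.span ℝ (reducedFamily n : Set (E3 → ℝ)) := by
  classical
  induction c using Nat.strong_induction_on with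
  | _ c ih =>
    intro a j hc ha hj
    rw [Fin.sum_univ_three] at ha
    by_cases h : 2 ≤ c
    · rw [wmono_reduce a (by omega)]
      refine Submodule.sub_mem _ (Submodule.sub_mem _ (Submodule.sub_mem _ ?_ ?_) ?_) ?_
      · have : (j : ℝ) + 1 / 2 - 1 = ((j - 1 : ℕ) : ℝ) + 1 / 2 := by
          rw [Nat.cast_sub (by omega)]; push_cast; ring
        rw [this]
        exact ih (c - 2) (by omega) _ _ (by simp [hc])
          (by simp [Fin.sum_univ_three]; omega) (by omega)
      all_goals
        exact ih (c - 2) (by omega) _ _ (by simp [hc]) (by simp [Fin.sum_univ_three]; omega) hj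
    · refine Submodule.subset_span ?_
      rw [reducedFamily, Finset.coe_image]
      have hc' : a 2 = 0 ∨ a 2 = 1 := by omega
      rcases hc' with h0 | h0
      · refine ⟨⟨j, a 0, a 1⟩, ?_, ?_⟩
        · simp [reducedIndex]; omega
        · have : reducedExponent ⟨j, a 0, a 1⟩ = a := by
            rw [reducedExponent, if_pos (by simp only; omega)]
            ext i; fin_cases i <;> simp [h0]
          simp only [this]
      -- Here a₀ + a₁ ≤ j - 1, so (j - a₀) + (j - a₁) > j and the second branch of `reducedExponent`
      -- is selected.
      · refine ⟨⟨j, j - a 0, j - a 1⟩, ?_, ?_⟩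
        · simp [reducedIndex]; omega
        · have : reducedExponent ⟨j, j - a 0, j - a 1⟩ = a := by
            rw [reducedExponent, if_neg (by simp only; omega)]
            ext i; fin_cases i <;> simp [h0] <;> omega
          simp only [this]

theorem wmonoSpan_le_span_reduced (n : ℕ) :
    wmonoSpan n ≤ Submodule.span ℝ (reducedFamily n : Set (E3 → ℝ)) := by
  rw [wmonoSpan, Submodule.span_le]
  rintro _ ⟨a, j, ha, hj, rfl⟩
  exact wmono_mem_span_reduced n _ a j rfl ha hj

instance finiteDimensional_wmonoSpan (n : ℕ) : FiniteDimensional ℝ (wmonoSpan n) :=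
  Submodule.finiteDimensional_of_le (wmonoSpan_le_span_reduced n)

theorem finrank_wmonoSpan_le (n : ℕ) :
    Module.finrank ℝ (wmonoSpan n) ≤ ∑ k ∈ Finset.range n, (k + 1) ^ 2 := by
  classical
  exact (Submodule.finrank_mono (wmonoSpan_le_span_reduced n)).trans
    ((finrank_span_finset_le_card _).trans
      (Finset.card_image_le.trans (card_reducedIndex n).le))

/-! ### Gradients and weak gradients -/

theorem gradient_apply_eq_pd (f : E3 → ℝ) (x : E3) (i : Fin 3) : (∇ f x) i = pd i f x := by
  have h : inner ℝ (∇ f x) (EuclideanSpace.single i (1 : ℝ)) = pd i f x := by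
    rw [gradient, InnerProductSpace.toDual_symm_apply, pd]
  rw [← h, EuclideanSpace.inner_single_right]
  simp

theorem inner_gradient_eq_sum (G : E3) (f : E3 → ℝ) (x : E3) :
    inner ℝ G (∇ f x) = ∑ i, G i * pd i f x := by
  simp only [PiLp.inner_apply, gradient_apply_eq_pd]
  exact Finset.sum_congr rfl fun i _ => by simp [mul_comm]

theorem continuous_gradient {f : E3 → ℝ} (hf : ContDiff ℝ ∞ f) : Continuous (∇ f) :=
  (InnerProductSpace.toDual ℝ E3).symm.continuous.comp (hf.continuous_fderiv (by simp))

theorem norm_gradient_le {f : E3 → ℝ} {x : E3} {C : ℝ} (h : ∀ i, |pd i f x| ≤ C) :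
    ‖∇ f x‖ ≤ 2 * C := by
  have hC : 0 ≤ C := (abs_nonneg _).trans (h 0)
  -- The constant 2 replaces √3: the sum of the three squares is at most 3C² ≤ (2C)².
  refine abs_le_of_sq_le_sq' ?_ (by positivity) |>.2
  rw [← sum_coord_sq]
  have h2 : ∀ i, (∇ f x) i ^ 2 ≤ C ^ 2 := fun i => by
    rw [gradient_apply_eq_pd, ← sq_abs]
    exact pow_le_pow_left₀ (abs_nonneg _) (h i) 2
  rw [Fin.sum_univ_three]
  nlinarith [h2 0, h2 1, h2 2]

theorem hasCompactSupport_pd {f : E3 → ℝ} (hf : HasCompactSupport f) (i : Fin 3) :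
    HasCompactSupport (pd i f) :=
  (hf.fderiv ℝ).comp_left (g := fun L : E3 →L[ℝ] ℝ => L (EuclideanSpace.single i 1)) rfl

theorem hasCompactSupport_gradient {f : E3 → ℝ} (hf : HasCompactSupport f) :
    HasCompactSupport (∇ f) :=
  (hf.fderiv ℝ).comp_left (g := (InnerProductSpace.toDual ℝ E3).symm) (map_zero _)

/-- Integration by parts against a compactly supported function. -/
theorem integral_mul_pd_eq_neg {f g : E3 → ℝ} (hf : ContDiff ℝ ∞ f) (hg : ContDiff ℝ ∞ g)
    (hc : HasCompactSupport g) (i : Fin 3) :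
    ∫ x, f x * pd i g x = -∫ x, pd i f x * g x := by
  refine integral_mul_fderiv_eq_neg_fderiv_mul_of_integrable ?_ ?_ ?_
    (fun x _ => hf.differentiable (by simp) x) (fun x _ => hg.differentiable (by simp) x)
  · exact ((contDiff_pd hf i).continuous.mul hg.continuous).integrable_of_hasCompactSupport
      hc.mul_left
  · exact (hf.continuous.mul (contDiff_pd hg i).continuous).integrable_of_hasCompactSupport
      (hasCompactSupport_pd hc i).mul_left
  · exact (hf.continuous.mul hg.continuous).integrable_of_hasCompactSupport hc.mul_left

theorem integral_apply_E3 {F : E3 → E3} (hF : Integrable F) (i : Fin 3) :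
    (∫ x, F x) i = ∫ x, F x i :=
  ((EuclideanSpace.proj i : E3 →L[ℝ] ℝ).integral_comp_comm hF).symm

theorem hasWeakGradient_of_contDiff {v : E3 → ℝ} (hv : ContDiff ℝ ∞ v) :
    HasWeakGradient v (∇ v) := by
  have hg := continuous_gradient hv
  refine ⟨hv.continuous.locallyIntegrable, hg.locallyIntegrable, fun φ hφ hc => ?_⟩
  have h1 : Integrable fun x => v x • ∇ φ x :=
    (hv.continuous.smul (continuous_gradient hφ)).integrable_of_hasCompactSupport
      (hasCompactSupport_gradient hc).smul_left
  have h2 : Integrable fun x => φ x • ∇ v x :=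
    (hφ.continuous.smul hg).integrable_of_hasCompactSupport hc.smul_right
  ext i
  rw [integral_apply_E3 h1, PiLp.neg_apply, integral_apply_E3 h2]
  simp only [PiLp.smul_apply, smul_eq_mul, gradient_apply_eq_pd]
  rw [integral_mul_pd_eq_neg hv hφ hc]
  simp only [mul_comm]

theorem HasWeakGradient.ae_eq {v : E3 → ℝ} {G G' : E3 → E3} (h : HasWeakGradient v G)
    (h' : HasWeakGradient v G') : G =ᵐ[volume] G' := by
  refine ae_eq_of_integral_contDiff_smul_eq h.2.1 h'.2.1 fun g hg hc => ?_
  have := (h.2.2 g hg hc).symm.trans (h'.2.2 g hg hc)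
  exact neg_injective this

theorem HasWeakGradient.weakGradient_ae_eq {v : E3 → ℝ} {G : E3 → E3} (h : HasWeakGradient v G) :
    weakGradient v =ᵐ[volume] G := by
  have hex : ∃ G, HasWeakGradient v G := ⟨G, h⟩
  rw [weakGradient, dif_pos hex]
  exact hex.choose_spec.ae_eq h

theorem HasWeakGradient.sub {v w : E3 → ℝ} {G K : E3 → E3} (h : HasWeakGradient v G)
    (h' : HasWeakGradient w K) : HasWeakGradient (v - w) (G - K) := by
  refine ⟨h.1.sub h'.1, h.2.1.sub h'.2.1, fun φ hφ hc => ?_⟩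
  have hg := continuous_gradient hφ
  have hgc := hasCompactSupport_gradient hc
  simp only [Pi.sub_apply, sub_smul, smul_sub]
  rw [integral_sub (h.1.integrable_smul_right_of_hasCompactSupport hg hgc)
      (h'.1.integrable_smul_right_of_hasCompactSupport hg hgc),
    integral_sub (h.2.1.integrable_smul_left_of_hasCompactSupport hφ.continuous hc)
      (h'.2.1.integrable_smul_left_of_hasCompactSupport hφ.continuous hc),
    h.2.2 φ hφ hc, h'.2.2 φ hφ hc]
  abel

/-! ### Integrability -/

/-- The decay |x|^{2c} has exponent -2c ≥ 4, larger than the dimension 3. -/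
theorem integrable_weight {c : ℝ} (hc : c ≤ -2) : Integrable fun x : E3 => (‖x‖ ^ 2 + 1) ^ c := by
  have h := integrable_rpow_neg_one_add_norm_sq (E := E3) (μ := volume) (r := -2 * c) (by
    simp; linarith)
  refine h.congr (ae_of_all _ fun x => ?_)
  simp only
  rw [add_comm]; congr 1; ring

theorem memLp_two_of_norm_le {F : Type*} [NormedAddCommGroup F] {f : E3 → F} (hf : Continuous f)
    {C : ℝ} (h : ∀ x, ‖f x‖ ≤ C * (‖x‖ ^ 2 + 1) ^ (-1 : ℝ)) : MemLp f 2 := by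
  rw [← memLp_norm_iff hf.aestronglyMeasurable,
    memLp_two_iff_integrable_sq hf.norm.aestronglyMeasurable]
  refine ((integrable_weight le_rfl).const_mul (C ^ 2)).mono'
    (hf.norm.pow 2).aestronglyMeasurable (ae_of_all _ fun x => ?_)
  rw [Real.norm_eq_abs, abs_of_nonneg (by positivity)]
  refine (pow_le_pow_left₀ (norm_nonneg _) (h x) 2).trans (le_of_eq ?_)
  rw [mul_pow, ← Real.rpow_mul_natCast (normSq_add_one_pos x).le]
  norm_num

theorem exists_norm_gradient_le {n : ℕ} {v : E3 → ℝ} (hv : v ∈ wmonoSpan n) :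
    ∃ C, 0 ≤ C ∧ ∀ x, ‖∇ v x‖ ≤ C * (‖x‖ ^ 2 + 1) ^ (-1 : ℝ) := by
  obtain ⟨C, hC, h⟩ := abs_le_of_mem_wmonoSpan hv
  exact ⟨2 * C, by positivity, fun x => by
    rw [mul_assoc]; exact norm_gradient_le (h x).2⟩

theorem memLp_gradient {n : ℕ} {v : E3 → ℝ} (hv : v ∈ wmonoSpan n) : MemLp (∇ v) 2 := by
  obtain ⟨C, -, h⟩ := exists_norm_gradient_le hv
  exact memLp_two_of_norm_le (continuous_gradient (contDiff_of_mem_wmonoSpan hv)) h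

theorem memW10_of_mem_wmonoSpan {n : ℕ} {v : E3 → ℝ} (hv : v ∈ wmonoSpan n) : MemW10 v := by
  have hcd := contDiff_of_mem_wmonoSpan hv
  refine ⟨?_, _, hasWeakGradient_of_contDiff hcd, memLp_gradient hv⟩
  obtain ⟨C, hC, h⟩ := abs_le_of_mem_wmonoSpan hv
  have hpos : ∀ x : E3, 0 < 1 + ‖x‖ ^ 2 := fun x => by positivity
  refine memLp_two_of_norm_le (C := C) ?_ fun x => ?_
  · exact hcd.continuous.div (by fun_prop) fun x => (Real.sqrt_pos.2 (hpos x)).ne'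
  · rw [norm_div, Real.norm_eq_abs, Real.norm_eq_abs, abs_of_pos (Real.sqrt_pos.2 (hpos x)),
      div_le_iff₀ (Real.sqrt_pos.2 (hpos x)), add_comm (1 : ℝ), Real.sqrt_eq_rpow, mul_assoc,
      ← Real.rpow_add (normSq_add_one_pos x)]
    refine (h x).1.trans (le_of_eq ?_)
    norm_num

theorem integrable_inner_of_memLp {α : Type*} [MeasurableSpace α] {μ : Measure α} {f g : α → E3}
    (hf : MemLp f 2 μ) (hg : MemLp g 2 μ) : Integrable (fun x => inner ℝ (f x) (g x)) μ := by
  refine (hf.norm.integrable_mul hg.norm).mono (hf.1.inner hg.1) (ae_of_all _ fun x => ?_)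
  simpa using abs_real_inner_le_norm (f x) (g x)

theorem integrable_weight_mul_mul {m n : ℕ} {u v : E3 → ℝ} (hu : u ∈ wmonoSpan m)
    (hv : v ∈ wmonoSpan n) : Integrable fun x => 4 / (‖x‖ ^ 2 + 1) ^ 2 * u x * v x := by
  obtain ⟨C, hC, h⟩ := abs_le_of_mem_wmonoSpan hu
  obtain ⟨D, hD, h'⟩ := abs_le_of_mem_wmonoSpan hv
  have hcu := (contDiff_of_mem_wmonoSpan hu).continuous
  have hcv := (contDiff_of_mem_wmonoSpan hv).continuous
  refine ((integrable_weight (c := -3) (by norm_num)).const_mul (4 * (C * D))).mono' ?_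
    (ae_of_all _ fun x => ?_)
  · refine Continuous.aestronglyMeasurable (((continuous_const.div (by fun_prop) fun x => ?_).mul
      hcu).mul hcv)
    positivity
  · have hs := normSq_add_one_pos x
    rw [Real.norm_eq_abs, abs_mul, abs_mul, abs_of_pos (by positivity)]
    have e : (‖x‖ ^ 2 + 1) ^ (-3 : ℝ) = ((‖x‖ ^ 2 + 1) ^ 2)⁻¹ *
        ((‖x‖ ^ 2 + 1) ^ (-(1 / 2) : ℝ) * (‖x‖ ^ 2 + 1) ^ (-(1 / 2) : ℝ)) := by
      rw [← Real.rpow_add hs, ← Real.rpow_natCast (‖x‖ ^ 2 + 1) 2, ← Real.rpow_neg hs.le,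
        ← Real.rpow_add hs]
      norm_num
    rw [e, mul_assoc]
    calc _ ≤ 4 / (‖x‖ ^ 2 + 1) ^ 2 * ((C * (‖x‖ ^ 2 + 1) ^ (-(1 / 2) : ℝ)) *
          (D * (‖x‖ ^ 2 + 1) ^ (-(1 / 2) : ℝ))) := by
          refine mul_le_mul_of_nonneg_left (mul_le_mul (h x).1 (h' x).1 (abs_nonneg _) ?_)
            (by positivity)
          positivity
      _ = _ := by ring

/-! ### Approximation by test functions -/

open Filter Topology in
/-- Every element of `wmonoSpan n` is a limit of test functions, dominated together with their
gradients. -/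
theorem exists_testFunction_approx {n : ℕ} {v : E3 → ℝ} (hv : v ∈ wmonoSpan n) :
    ∃ φ : ℕ → E3 → ℝ, (∀ k, ContDiff ℝ ∞ (φ k)) ∧ (∀ k, HasCompactSupport (φ k)) ∧
      (∀ k x, |φ k x| ≤ |v x|) ∧ (∀ x, Tendsto (fun k => φ k x) atTop (𝓝 (v x))) ∧
      (∃ C, ∀ k x, ‖∇ (φ k) x‖ ≤ C * (‖x‖ ^ 2 + 1) ^ (-1 : ℝ)) ∧
      ∀ x, Tendsto (fun k => ∇ (φ k) x) atTop (𝓝 (∇ v x)) := by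
  obtain ⟨C, hC, h⟩ := abs_le_of_mem_wmonoSpan hv
  have hcd := contDiff_of_mem_wmonoSpan hv
  -- The approximants are η(x/(k+1)) v(x), with η equal to 1 on the unit ball and supported in the
  -- ball of radius 2.
  let η : ContDiffBump (0 : E3) := ⟨1, 2, one_pos, one_lt_two⟩
  have hη : ContDiff ℝ ∞ η := η.contDiff
  obtain ⟨D, hD⟩ := (hη.continuous_fderiv (by simp)).bounded_above_of_compact_support
    (η.hasCompactSupport.fderiv ℝ)
  have hD0 : 0 ≤ D := (norm_nonneg _).trans (hD 0)
  let r : ℕ → ℝ := fun k => ((k : ℝ) + 1)⁻¹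
  have hr : ∀ k, 0 < r k := fun k => by positivity
  have hr0 : Tendsto r atTop (𝓝 0) := by
    simpa [r, one_div] using tendsto_one_div_add_atTop_nhds_zero_nat (𝕜 := ℝ)
  have hη1 : ∀ x, |η x| ≤ 1 := fun x => by
    rw [abs_of_nonneg η.nonneg]; exact η.le_one
  have hcomp : ∀ k, ContDiff ℝ ∞ fun x : E3 => η (r k • x) := fun k =>
    hη.comp (contDiff_const_smul (r k))
  have hlim : ∀ x : E3, Tendsto (fun k => η (r k • x)) atTop (𝓝 1) := fun x => by
    have h1 : η 0 = 1 := η.one_of_mem_closedBall (by simp [η])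
    rw [← h1]
    refine (hη.continuous.tendsto 0).comp ?_
    simpa using hr0.smul_const x
  have hpd : ∀ k i x, pd i (fun x : E3 => η (r k • x)) x =
      r k * fderiv ℝ η (r k • x) (EuclideanSpace.single i 1) := fun k i x => by
    rw [pd]
    have := ((hη.differentiable (by simp) (r k • x)).hasFDerivAt).comp x
      ((hasFDerivAt_id x).const_smul (r k))
    have e : (fun x : E3 => η (r k • x)) = η ∘ HSMul.hSMul (r k) := rfl
    rw [e, this.fderiv]
    simp
  have hpd1 : ∀ k i x, |fderiv ℝ η (r k • x) (EuclideanSpace.single i 1)| ≤ D := fun k i x => by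
    refine ((fderiv ℝ η (r k • x)).le_opNorm _).trans ?_
    simpa using hD (r k • x)
  have hpd2 : ∀ k i x, |pd i (fun x : E3 => η (r k • x)) x| ≤
      3 * D * (‖x‖ ^ 2 + 1) ^ (-(1 / 2) : ℝ) := fun k i x => by
    rw [hpd, abs_mul, abs_of_pos (hr k)]
    have hs := normSq_add_one_pos x
    rw [Real.rpow_neg hs.le, ← Real.sqrt_eq_rpow, ← div_eq_mul_inv, le_div_iff₀ (by positivity)]
    -- On the support of the cutoff, (|x|² + 1)^{1/2} ≤ 3(k+1), so the factor 1/(k+1) from the chain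
    -- rule is at most 3(|x|² + 1)^{-1/2}, uniformly in k. Multiplied by the decay of v this yields
    -- a square integrable majorant.
    by_cases hx : ‖x‖ ≤ 2 * ((k : ℝ) + 1)
    · have h3 : √(‖x‖ ^ 2 + 1) ≤ 3 * ((k : ℝ) + 1) := by
        rw [Real.sqrt_le_left (by positivity)]
        nlinarith [norm_nonneg x, (Nat.cast_nonneg k : (0 : ℝ) ≤ k)]
      have h4 : r k * √(‖x‖ ^ 2 + 1) ≤ 3 := by
        simp only [r]
        rw [inv_mul_le_iff₀ (by positivity)]; linarith
      calc r k * _ * √(‖x‖ ^ 2 + 1) = (r k * √(‖x‖ ^ 2 + 1)) *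
            |fderiv ℝ η (r k • x) (EuclideanSpace.single i 1)| := by ring
        _ ≤ 3 * D := mul_le_mul h4 (hpd1 k i x) (abs_nonneg _) (by norm_num)
    · have : fderiv ℝ η (r k • x) = 0 := by
        have hns : r k • x ∉ tsupport η := by
          rw [η.tsupport_eq, Metric.mem_closedBall, dist_zero_right, norm_smul,
            Real.norm_of_nonneg (hr k).le, not_le]
          push Not at hx
          simp only [r, η]
          rw [lt_inv_mul_iff₀ (by positivity)]; linarith
        exact image_eq_zero_of_notMem_tsupport fun h => hns (tsupport_fderiv_subset ℝ h)
      rw [this]; simp [hD0]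
  have hmul : ∀ k i x, pd i (fun x : E3 => η (r k • x) * v x) x =
      η (r k • x) * pd i v x + v x * pd i (fun x : E3 => η (r k • x)) x := fun k i x => by
    rw [pd, fderiv_fun_mul ((hcomp k).differentiable (by simp) x) (hcd.differentiable (by simp) x)]
    simp [pd]
  refine ⟨fun k x => η (r k • x) * v x, fun k => (hcomp k).mul hcd, fun k => ?_, fun k x => ?_,
    fun x => ?_, ⟨2 * (C + C * (3 * D)), fun k x => ?_⟩, fun x => ?_⟩
  · exact (η.hasCompactSupport.comp_smul (hr k).ne').mul_right
  · rw [abs_mul]; exact mul_le_of_le_one_left (abs_nonneg _) (hη1 _)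
  · simpa using (hlim x).mul_const (v x)
  · rw [mul_assoc]
    refine norm_gradient_le fun i => ?_
    rw [hmul]
    have hs := normSq_add_one_pos x
    have e : (‖x‖ ^ 2 + 1) ^ (-1 : ℝ) =
        (‖x‖ ^ 2 + 1) ^ (-(1 / 2) : ℝ) * (‖x‖ ^ 2 + 1) ^ (-(1 / 2) : ℝ) := by
      rw [← Real.rpow_add hs]; norm_num
    refine (abs_add_le _ _).trans ?_
    rw [add_mul, abs_mul, abs_mul]
    refine add_le_add ((mul_le_of_le_one_left (abs_nonneg _) (hη1 _)).trans ((h x).2 i)) ?_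
    refine (mul_le_mul (h x).1 (hpd2 k i x) (abs_nonneg _) (by positivity)).trans (le_of_eq ?_)
    rw [e]; ring
  · have key : ∀ i, Tendsto (fun k => (∇ (fun x : E3 => η (r k • x) * v x) x) i) atTop
        (𝓝 ((∇ v x) i)) := fun i => by
      simp only [gradient_apply_eq_pd, hmul]
      have h0 : Tendsto (fun k => pd i (fun x : E3 => η (r k • x)) x) atTop (𝓝 0) := by
        refine squeeze_zero_norm (a := fun k => r k * D) (fun k => ?_) (by simpa using hr0.mul_const D)
        rw [hpd, Real.norm_eq_abs, abs_mul, abs_of_pos (hr k)]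
        exact mul_le_mul_of_nonneg_left (hpd1 k i x) (hr k).le
      simpa using ((hlim x).mul_const (pd i v x)).add (h0.const_mul (v x))
    have := (PiLp.continuous_toLp 2 (fun _ : Fin 3 => ℝ)).tendsto _ |>.comp (tendsto_pi_nhds.2 key)
    exact this

open Filter Topology in
-- Dominated convergence with majorant |G| times a square integrable weight. It is used both on Ω
-- with G = M and on the whole space.
theorem tendsto_setIntegral_inner_gradient {Ω : Set E3} {G : E3 → E3}
    (hG : MemLp G 2 (volume.restrict Ω)) {φ : ℕ → E3 → ℝ} {v : E3 → ℝ} {C : ℝ}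
    (hφ : ∀ k, ContDiff ℝ ∞ (φ k))
    (hb : ∀ k x, ‖∇ (φ k) x‖ ≤ C * (‖x‖ ^ 2 + 1) ^ (-1 : ℝ))
    (hl : ∀ x, Tendsto (fun k => ∇ (φ k) x) atTop (𝓝 (∇ v x))) :
    Tendsto (fun k => ∫ x in Ω, inner ℝ (G x) (∇ (φ k) x)) atTop
      (𝓝 (∫ x in Ω, inner ℝ (G x) (∇ v x))) := by
  have hw : MemLp (fun x : E3 => C * (‖x‖ ^ 2 + 1) ^ (-1 : ℝ)) 2 (volume.restrict Ω) := by
    refine MemLp.mono_measure Measure.restrict_le_self (memLp_two_of_norm_le (C := |C|) ?_ ?_)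
    · exact continuous_const.mul (Continuous.rpow_const (by fun_prop)
        fun x => Or.inl (normSq_add_one_pos x).ne')
    · intro x
      rw [norm_mul, Real.norm_eq_abs, Real.norm_of_nonneg
        (Real.rpow_nonneg (normSq_add_one_pos x).le _)]
  refine tendsto_integral_of_dominated_convergence
    (fun x => ‖G x‖ * (C * (‖x‖ ^ 2 + 1) ^ (-1 : ℝ))) (fun k => ?_) ?_ (fun k => ?_) ?_
  · exact hG.1.inner (continuous_gradient (hφ k)).aestronglyMeasurable
  · exact hG.norm.integrable_mul hw
  · refine ae_of_all _ fun x => ?_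
    exact (abs_real_inner_le_norm _ _).trans
      (mul_le_mul_of_nonneg_left (hb k x) (norm_nonneg _))
  · exact ae_of_all _ fun x => tendsto_const_nhds.inner (hl x)

open Filter Topology in
/-- Green's formula. -/
theorem integral_inner_gradient_eq {m n p : ℕ} {u v w : E3 → ℝ} (hu : u ∈ wmonoSpan m)
    (hv : v ∈ wmonoSpan n) (hw : w ∈ wmonoSpan p)
    (h : ∀ x, ∑ i, pd i (pd i u) x = -(4 / (‖x‖ ^ 2 + 1) ^ 2) * w x) :
    ∫ x, inner ℝ (∇ u x) (∇ v x) = ∫ x, 4 / (‖x‖ ^ 2 + 1) ^ 2 * w x * v x := by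
  obtain ⟨φ, hφ, hc, hle, hlim, ⟨C, hb⟩, hl⟩ := exists_testFunction_approx hv
  have hcu := contDiff_of_mem_wmonoSpan hu
  have hcw := (contDiff_of_mem_wmonoSpan hw).continuous
  have h1 := tendsto_setIntegral_inner_gradient (Ω := Set.univ) (G := ∇ u)
    (by simpa using memLp_gradient hu) hφ hb hl
  simp only [Measure.restrict_univ] at h1
  have hcont : Continuous fun x : E3 => 4 / (‖x‖ ^ 2 + 1) ^ 2 * w x :=
    (continuous_const.div (by fun_prop) fun x => by positivity).mul hcw
  have h2 : Tendsto (fun k => ∫ x, 4 / (‖x‖ ^ 2 + 1) ^ 2 * w x * φ k x) atTop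
      (𝓝 (∫ x, 4 / (‖x‖ ^ 2 + 1) ^ 2 * w x * v x)) := by
    refine tendsto_integral_of_dominated_convergence _
      (fun k => (hcont.mul (hφ k).continuous).aestronglyMeasurable)
      (integrable_weight_mul_mul hw hv).norm (fun k => ae_of_all _ fun x => ?_)
      (ae_of_all _ fun x => (hlim x).const_mul _)
    rw [norm_mul, norm_mul _ (v x)]
    exact mul_le_mul_of_nonneg_left (hle k x) (norm_nonneg _)
  -- Both sides are limits along the test functions φ_k, for which integration by parts has no
  -- boundary term.
  refine tendsto_nhds_unique h1 (h2.congr fun k => ?_)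
  simp only [inner_gradient_eq_sum, gradient_apply_eq_pd]
  have hint : ∀ i, Integrable fun x => pd i u x * pd i (φ k) x := fun i =>
    ((contDiff_pd hcu i).continuous.mul
      (contDiff_pd (hφ k) i).continuous).integrable_of_hasCompactSupport
        (hasCompactSupport_pd (hc k) i).mul_left
  have hint' : ∀ i, Integrable fun x => pd i (pd i u) x * φ k x := fun i =>
    ((contDiff_pd (contDiff_pd hcu i) i).continuous.mul
      (hφ k).continuous).integrable_of_hasCompactSupport (hc k).mul_left
  rw [integral_finsetSum _ fun i _ => hint i]
  simp only [integral_mul_pd_eq_neg (contDiff_pd hcu _) (hφ k) (hc k)]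
  rw [Finset.sum_neg_distrib, ← integral_finsetSum _ fun i _ => hint' i, ← integral_neg]
  refine integral_congr_ae (ae_of_all _ fun x => ?_)
  simp only [← Finset.sum_mul, h]
  ring

/-! ### The magnetic potential -/

theorem laplacian_eq_sum_pd {φ : E3 → ℝ} (hφ : ContDiff ℝ ∞ φ) (x : E3) :
    (Δ φ) x = ∑ i, pd i (pd i φ) x := by
  rw [InnerProductSpace.laplacian_eq_iteratedFDeriv_orthonormalBasis φ
    (EuclideanSpace.basisFun (Fin 3) ℝ)]
  refine Finset.sum_congr rfl fun i _ => ?_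
  rw [iteratedFDeriv_two_apply]
  have hd : DifferentiableAt ℝ (fderiv ℝ φ) x :=
    (hφ.fderiv_right (m := ∞) (by simp)).differentiable (by simp) x
  have : pd i φ = fun y => (fderiv ℝ φ y) (EuclideanSpace.single i 1) := rfl
  rw [this, pd, fderiv_clm_apply hd (differentiableAt_const _)]
  simp

theorem HasWeakGradient.integral_mul_pd {v : E3 → ℝ} {G : E3 → E3} (h : HasWeakGradient v G)
    {ψ : E3 → ℝ} (hψ : ContDiff ℝ ∞ ψ) (hc : HasCompactSupport ψ) (i : Fin 3) :
    Integrable (fun x => v x * pd i ψ x) ∧ Integrable (fun x => G x i * ψ x) ∧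
      ∫ x, v x * pd i ψ x = -∫ x, G x i * ψ x := by
  have h1 := h.1.integrable_smul_right_of_hasCompactSupport (continuous_gradient hψ)
    (hasCompactSupport_gradient hc)
  have h2 := h.2.1.integrable_smul_left_of_hasCompactSupport hψ.continuous hc
  have h1' := (EuclideanSpace.proj i : E3 →L[ℝ] ℝ).integrable_comp h1
  have h2' := (EuclideanSpace.proj i : E3 →L[ℝ] ℝ).integrable_comp h2
  have h3 := congrArg (fun y : E3 => y i) (h.2.2 ψ hψ hc)
  simp only [integral_apply_E3 h1, PiLp.neg_apply, integral_apply_E3 h2] at h3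
  simp only [PiLp.smul_apply, smul_eq_mul, gradient_apply_eq_pd, PiLp.proj_apply] at h1' h2' h3
  refine ⟨h1', ?_, ?_⟩
  · simpa only [mul_comm] using h2'
  · rw [h3]; simp only [mul_comm]

/-- The definition of the weak gradient is applied with ∂_i φ as test function; summing over i turns
∫ U Δφ into -∫ G · ∇φ. -/
theorem IsMagneticPotential.integral_inner_test {Ω : Set E3} {M : E3 → E3} {U : E3 → ℝ}
    (hU : IsMagneticPotential Ω M U) {G : E3 → E3} (hG : HasWeakGradient U G) {φ : E3 → ℝ}
    (hφ : ContDiff ℝ ∞ φ) (hc : HasCompactSupport φ) :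
    ∫ x, inner ℝ (G x) (∇ φ x) = ∫ x in Ω, inner ℝ (M x) (∇ φ x) := by
  have key := fun i => hG.integral_mul_pd (contDiff_pd hφ i) (hasCompactSupport_pd hc i) i
  have h := hU.2 φ hφ hc
  simp only [laplacian_eq_sum_pd hφ, Finset.mul_sum] at h
  rw [integral_finsetSum _ fun i _ => (key i).1] at h
  simp only [(key _).2.2] at h
  rw [Finset.sum_neg_distrib, ← integral_finsetSum _ fun i _ => (key i).2.1] at h
  simpa only [inner_gradient_eq_sum] using neg_injective h

/-- The functions of `wmonoSpan n` need not be compactly supported, so the weak equation is carried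
over to them by cutoff. -/
theorem IsMagneticPotential.integral_inner {Ω : Set E3} {M : E3 → E3}
    (hM : MemLp M 2 (volume.restrict Ω)) {U : E3 → ℝ} (hU : IsMagneticPotential Ω M U)
    {G : E3 → E3} (hG : HasWeakGradient U G) (hG2 : MemLp G 2) {n : ℕ} {v : E3 → ℝ}
    (hv : v ∈ wmonoSpan n) :
    ∫ x, inner ℝ (G x) (∇ v x) = ∫ x in Ω, inner ℝ (M x) (∇ v x) := by
  obtain ⟨φ, hφ, hc, -, -, ⟨C, hb⟩, hl⟩ := exists_testFunction_approx hv
  have h1 := tendsto_setIntegral_inner_gradient (Ω := Set.univ) (G := G) (by simpa using hG2)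
    hφ hb hl
  simp only [Measure.restrict_univ] at h1
  have h2 := tendsto_setIntegral_inner_gradient hM hφ hb hl
  exact tendsto_nhds_unique h1 (h2.congr fun k => (hU.integral_inner_test hG (hφ k) (hc k)).symm)

/-! ### Gegenbauer equations -/

section Gegenbauer

open Polynomial

/-- `q` solves the Gegenbauer equation `(1 - t²) q'' - (e + 1) t q' + μ q = 0`. -/
def GegenbauerEq (e μ : ℝ) (q : ℝ[X]) : Prop :=
  (1 - X ^ 2) * derivative (derivative q) - C (e + 1) * X * derivative q + C μ * q = 0

theorem GegenbauerEq.derivative {e μ : ℝ} {q : ℝ[X]} (h : GegenbauerEq e μ q) :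
    GegenbauerEq (e + 2) (μ - e - 1) (derivative q) := by
  have h' := congrArg Polynomial.derivative h
  simp only [derivative_add, derivative_sub, derivative_mul, derivative_C, derivative_one,
    derivative_X_pow, derivative_X, derivative_zero, zero_mul, zero_add, zero_sub] at h'
  unfold GegenbauerEq
  simp only [map_add, map_sub, map_one, map_ofNat] at h' ⊢
  norm_num at h' ⊢
  have c2 : (C 2 : ℝ[X]) = 2 := rfl
  linear_combination h' + X * Polynomial.derivative (Polynomial.derivative q) * c2

/-- The eigenvalue drops by e + 1, e + 3, ..., e + 2n - 1 in turn, in total by n(e + n). -/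
theorem GegenbauerEq.iterate {e μ : ℝ} {q : ℝ[X]} (h : GegenbauerEq e μ q) (n : ℕ) :
    GegenbauerEq (e + 2 * n) (μ - n * (e + n)) (Polynomial.derivative^[n] q) := by
  induction n with
  | zero => simpa using h
  | succ n ih =>
    rw [Function.iterate_succ_apply']
    convert ih.derivative using 1 <;> push_cast <;> ring

theorem GegenbauerEq.eval {e μ : ℝ} {q : ℝ[X]} (h : GegenbauerEq e μ q) (t : ℝ) :
    (1 - t ^ 2) * (Polynomial.derivative (Polynomial.derivative q)).eval t -
      (e + 1) * t * (Polynomial.derivative q).eval t + μ * q.eval t = 0 := by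
  have := congrArg (Polynomial.eval t) h
  simpa using this

/-- The integral `∫₀^π sin^e χ q(cos χ) p(cos χ) dχ`. -/
noncomputable def sinIntegral (e : ℕ) (q p : ℝ[X]) : ℝ :=
  ∫ χ in (0 : ℝ)..Real.pi, Real.sin χ ^ e * (q.eval (Real.cos χ) * p.eval (Real.cos χ))

theorem sinIntegral_comm (e : ℕ) (q p : ℝ[X]) : sinIntegral e q p = sinIntegral e p q := by
  simp only [sinIntegral, mul_comm (q.eval _)]

/-- Sturm-Liouville form with t = cos χ: integrate the derivative of sin^{e+1} χ · q'(cos χ) p(cos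
χ), whose boundary values vanish. Taking p = q gives a recursion for norms of successive
derivatives; exchanging p and q gives orthogonality for distinct eigenvalues. -/
theorem GegenbauerEq.mul_sinIntegral {e : ℕ} {μ : ℝ} {q : ℝ[X]} (h : GegenbauerEq e μ q)
    (p : ℝ[X]) : μ * sinIntegral e q p =
      sinIntegral (e + 2) (Polynomial.derivative q) (Polynomial.derivative p) := by
  have hd : ∀ (r : ℝ[X]) (χ : ℝ), HasDerivAt (fun χ => r.eval (Real.cos χ))
      ((Polynomial.derivative r).eval (Real.cos χ) * -Real.sin χ) χ := fun r χ =>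
    (r.hasDerivAt _).comp χ (Real.hasDerivAt_cos χ)
  have hc : ∀ r : ℝ[X], Continuous fun χ => r.eval (Real.cos χ) := fun r =>
    r.continuous.comp Real.continuous_cos
  have key : ∀ χ : ℝ, HasDerivAt (fun χ => Real.sin χ ^ (e + 1) *
      ((Polynomial.derivative q).eval (Real.cos χ) * p.eval (Real.cos χ)))
      (μ * (Real.sin χ ^ e * (q.eval (Real.cos χ) * p.eval (Real.cos χ))) -
        Real.sin χ ^ (e + 2) * ((Polynomial.derivative q).eval (Real.cos χ) *
          (Polynomial.derivative p).eval (Real.cos χ))) χ := fun χ => by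
    refine (((Real.hasDerivAt_sin χ).pow (e + 1)).mul
      ((hd (Polynomial.derivative q) χ).mul (hd p χ))).congr_deriv ?_
    have h1 := h.eval (Real.cos χ)
    have h2 : 1 - Real.cos χ ^ 2 = Real.sin χ ^ 2 := by rw [← Real.sin_sq_add_cos_sq χ]; ring
    rw [h2] at h1
    simp only [Nat.add_sub_cancel, Pi.mul_apply, Pi.pow_apply]
    push_cast
    linear_combination (-(Real.sin χ ^ e * p.eval (Real.cos χ))) * h1
  have hi1 : IntervalIntegrable (fun χ => μ * (Real.sin χ ^ e *
      (q.eval (Real.cos χ) * p.eval (Real.cos χ)))) volume 0 Real.pi :=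
    (continuous_const.mul ((Real.continuous_sin.pow e).mul
      ((hc q).mul (hc p)))).intervalIntegrable _ _
  have hi2 : IntervalIntegrable (fun χ => Real.sin χ ^ (e + 2) *
      ((Polynomial.derivative q).eval (Real.cos χ) * (Polynomial.derivative p).eval (Real.cos χ)))
      volume 0 Real.pi :=
    ((Real.continuous_sin.pow _).mul ((hc _).mul (hc _))).intervalIntegrable _ _
  have hint := intervalIntegral.integral_eq_sub_of_hasDerivAt (fun χ _ => key χ) (hi1.sub hi2)
  rw [intervalIntegral.integral_sub hi1 hi2, intervalIntegral.integral_const_mul] at hint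
  simp only [Real.sin_pi, Real.sin_zero, ne_eq, Nat.succ_ne_zero, not_false_eq_true, zero_pow,
    zero_mul, sub_self] at hint
  exact sub_eq_zero.1 hint

theorem GegenbauerEq.sinIntegral_eq_zero {e : ℕ} {μ ν : ℝ} {q p : ℝ[X]} (h : GegenbauerEq e μ q)
    (h' : GegenbauerEq e ν p) (hne : μ ≠ ν) : sinIntegral e q p = 0 := by
  have h1 := h.mul_sinIntegral p
  have h2 := h'.mul_sinIntegral q
  rw [sinIntegral_comm, sinIntegral_comm (e + 2)] at h2
  have : (μ - ν) * sinIntegral e q p = 0 := by rw [sub_mul, h1, h2, sub_self]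
  exact (mul_eq_zero.1 this).resolve_left (sub_ne_zero.2 hne)

/-! ### Chebyshev polynomials -/

theorem gegenbauerEq_T (n : ℤ) (d : ℕ) : GegenbauerEq ((2 * d : ℕ) : ℝ) ((n : ℝ) ^ 2 - d ^ 2)
    (Polynomial.derivative^[d] (Chebyshev.T ℝ n)) := by
  have h := Chebyshev.one_sub_X_sq_mul_iterate_derivative_T_eq_poly_in_T (R := ℝ) n d
  rw [Function.iterate_succ_apply', Function.iterate_succ_apply'] at h
  unfold GegenbauerEq
  rw [h]
  have c2 : (C 2 : ℝ[X]) = 2 := rfl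
  simp only [Nat.cast_mul, Nat.cast_ofNat, map_add, map_sub, map_mul, map_pow, map_one, c2,
    map_natCast, map_intCast]
  ring

/-- Each derivative multiplies the squared norm by (k+1)² - d² = (k+1-d)(k+1+d). Starting from π/2
for the Chebyshev polynomial itself, the product telescopes into factorials. -/
theorem sinIntegral_T_self (k l : ℕ) (hl : l ≤ k) :
    sinIntegral (2 * (l + 1)) (Polynomial.derivative^[l + 1] (Chebyshev.T ℝ ((k : ℤ) + 1)))
      (Polynomial.derivative^[l + 1] (Chebyshev.T ℝ ((k : ℤ) + 1))) = normConst k l := by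
  have step : ∀ d : ℕ,
      sinIntegral (2 * (d + 1)) (Polynomial.derivative^[d + 1] (Chebyshev.T ℝ ((k : ℤ) + 1)))
      (Polynomial.derivative^[d + 1] (Chebyshev.T ℝ ((k : ℤ) + 1))) =
      (((k : ℝ) + 1) ^ 2 - d ^ 2) *
      sinIntegral (2 * d) (Polynomial.derivative^[d] (Chebyshev.T ℝ ((k : ℤ) + 1)))
      (Polynomial.derivative^[d] (Chebyshev.T ℝ ((k : ℤ) + 1))) := fun d => by
    have h := (gegenbauerEq_T ((k : ℤ) + 1) d).mul_sinIntegral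
      (Polynomial.derivative^[d] (Chebyshev.T ℝ ((k : ℤ) + 1)))
    push_cast at h
    rw [h, ← Function.iterate_succ_apply' Polynomial.derivative]
    rfl
  induction l with
  | zero =>
    have h0 : sinIntegral (2 * 0) (Chebyshev.T ℝ ((k : ℤ) + 1)) (Chebyshev.T ℝ ((k : ℤ) + 1)) =
        Real.pi / 2 := by
      have := Chebyshev.integral_T_real_mul_self_measureT_of_ne_zero (n := k + 1) (by omega)
      rw [Chebyshev.integral_measureT_eq_integral_cos] at this
      simpa [sinIntegral] using this
    rw [step 0, Function.iterate_zero, id, h0, normConst, add_zero, Nat.sub_zero,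
      Nat.factorial_succ]
    have := Nat.factorial_ne_zero k
    push_cast
    field_simp
    ring
  | succ l ih =>
    rw [step (l + 1), ih (by omega), normConst, normConst]
    obtain ⟨c, rfl⟩ := Nat.exists_eq_add_of_le hl
    have e1 : l + 1 + c - l = c + 1 := by omega
    have e2 : l + 1 + c - (l + 1) = c := by omega
    rw [e1, e2, show l + 1 + c + (l + 1) + 1 = (l + 1 + c + l + 1) + 1 by ring,
      Nat.factorial_succ (l + 1 + c + l + 1), Nat.factorial_succ c]
    have := Nat.factorial_ne_zero c
    push_cast
    field_simp
    ring

theorem sinIntegral_T_of_ne {k k' : ℕ} (h : k ≠ k') (l : ℕ) :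
    sinIntegral (2 * (l + 1)) (Polynomial.derivative^[l + 1] (Chebyshev.T ℝ ((k : ℤ) + 1)))
      (Polynomial.derivative^[l + 1] (Chebyshev.T ℝ ((k' : ℤ) + 1))) = 0 := by
  refine (gegenbauerEq_T _ _).sinIntegral_eq_zero (gegenbauerEq_T _ _) fun e => h ?_
  push_cast at e
  have : ((k : ℝ) + 1) ^ 2 = ((k' : ℝ) + 1) ^ 2 := by linarith
  have := (pow_left_inj₀ (by positivity) (by positivity) two_ne_zero).1 this
  exact Nat.cast_injective (R := ℝ) (add_left_injective 1 this)

/-! ### Legendre polynomials -/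

/-- The derivative of order `l + m` of `(t² - 1)^l`. -/
noncomputable def legendreDeriv (l m : ℕ) : ℝ[X] :=
  Polynomial.derivative^[l + m] ((X ^ 2 - 1) ^ l)

/-- Differentiate the first order equation (t² - 1) f' = 2l t f for f = (t² - 1)^l. The parameter 1
- 2l can be negative, so `GegenbauerEq` takes a real parameter; after l + m derivatives it becomes
2m + 1. -/
theorem gegenbauerEq_X_sq_sub_one_pow (l : ℕ) :
    GegenbauerEq (1 - 2 * l) (2 * l) ((X ^ 2 - 1 : ℝ[X]) ^ l) := by
  have h : (X ^ 2 - 1 : ℝ[X]) * Polynomial.derivative ((X ^ 2 - 1 : ℝ[X]) ^ l) =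
      C (2 * l : ℝ) * X * (X ^ 2 - 1) ^ l := by
    rcases l with _ | l
    · simp
    · rw [derivative_pow_succ]
      have c2 : (C 2 : ℝ[X]) = 2 := rfl
      simp [c2]
      ring
  have h' := congrArg Polynomial.derivative h
  rw [derivative_mul, derivative_mul, derivative_mul] at h'
  unfold GegenbauerEq
  simp only [derivative_X_pow, derivative_one, derivative_X, sub_zero, mul_one, map_add, map_sub, map_mul, map_one, map_ofNat] at h' ⊢
  norm_num at h' ⊢
  have c2 : (C 2 : ℝ[X]) = 2 := rfl
  linear_combination -h' + X * Polynomial.derivative ((X ^ 2 - 1 : ℝ[X]) ^ l) * c2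

theorem gegenbauerEq_legendreDeriv (l m : ℕ) :
    GegenbauerEq ((2 * m + 1 : ℕ) : ℝ) (((l : ℝ) - m) * (l + m + 1)) (legendreDeriv l m) := by
  convert (gegenbauerEq_X_sq_sub_one_pow l).iterate (l + m) using 1
  · push_cast; ring
  · push_cast; ring
  · rfl

theorem legendreDeriv_self (l : ℕ) : legendreDeriv l l = C ((2 * l).factorial : ℝ) := by
  have h : ((X ^ 2 - 1 : ℝ[X]) ^ l).natDegree = 2 * l := by
    rw [natDegree_pow, ← C_1, natDegree_X_pow_sub_C, mul_comm]
  have hm : ((X ^ 2 - 1 : ℝ[X]) ^ l).Monic := by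
    rw [← C_1]; exact (monic_X_pow_sub_C (1 : ℝ) two_ne_zero).pow l
  have hd : (legendreDeriv l l).natDegree = 0 := by
    have := natDegree_iterate_derivative ((X ^ 2 - 1 : ℝ[X]) ^ l) (l + l)
    rw [legendreDeriv]; omega
  rw [eq_C_of_natDegree_eq_zero hd, legendreDeriv, coeff_iterate_derivative, zero_add, ← two_mul,
    ← h, hm.coeff_natDegree, h, Nat.descFactorial_self]
  simp

theorem integral_sin_pow_two_mul_add_one (l : ℕ) :
    ∫ χ in (0 : ℝ)..Real.pi, Real.sin χ ^ (2 * l + 1) =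
      (2 ^ l * (l.factorial : ℝ)) ^ 2 * (2 / (2 * l + 1)) / (2 * l).factorial := by
  rw [integral_sin_pow_odd]
  induction l with
  | zero => simp
  | succ l ih =>
    rw [Finset.prod_range_succ, ← mul_assoc, ih, show 2 * (l + 1) = 2 * l + 1 + 1 by ring,
      Nat.factorial_succ (2 * l + 1), Nat.factorial_succ (2 * l), Nat.factorial_succ l]
    have := Nat.factorial_ne_zero (2 * l)
    push_cast
    field_simp
    ring

/-- The recursion is run downwards in m from m = l, where the polynomial is the constant (2l)! and
the integral is a power of the sine. -/
theorem sinIntegral_legendreDeriv_self (l m : ℕ) (hm : m ≤ l) :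
    sinIntegral (2 * m + 1) (legendreDeriv l m) (legendreDeriv l m) =
      (2 ^ l * (l.factorial : ℝ)) ^ 2 * (2 / (2 * l + 1)) *
        ((l + m).factorial / (l - m).factorial) := by
  obtain ⟨d, rfl⟩ := Nat.exists_eq_add_of_le hm
  induction d generalizing m with
  | zero =>
    simp only [add_zero, legendreDeriv_self, sinIntegral, eval_C, Nat.sub_self, Nat.factorial_zero,
      intervalIntegral.integral_mul_const, integral_sin_pow_two_mul_add_one, ← two_mul]
    have := Nat.factorial_ne_zero (2 * m)
    field_simp
    simp
  | succ d ih =>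
    have h := (gegenbauerEq_legendreDeriv (m + (d + 1)) m).mul_sinIntegral
      (legendreDeriv (m + (d + 1)) m)
    have e : Polynomial.derivative (legendreDeriv (m + (d + 1)) m) =
        legendreDeriv (m + (d + 1)) (m + 1) := by
      rw [legendreDeriv, ← Function.iterate_succ_apply' Polynomial.derivative]; rfl
    have h2 := ih (m + 1) (by omega)
    rw [show m + 1 + d = m + (d + 1) by ring] at h2
    rw [e, show 2 * m + 1 + 2 = 2 * (m + 1) + 1 by ring, h2,
      show m + (d + 1) - (m + 1) = d by omega,
      show m + (d + 1) + (m + 1) = m + (d + 1) + m + 1 by ring, Nat.factorial_succ] at h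
    rw [show m + (d + 1) - m = d + 1 by omega, Nat.factorial_succ]
    -- This is the eigenvalue (l - m)(l + m + 1) for l = m + d + 1.
    have h3 : ((d : ℝ) + 1) * (m + (d + 1) + m + 1) ≠ 0 := by positivity
    refine mul_left_cancel₀ h3 ?_
    push_cast at h ⊢
    have h4 : (m + ((d : ℝ) + 1) - m) = d + 1 := by ring
    rw [h4] at h
    rw [h]
    have := Nat.factorial_ne_zero d
    field_simp

theorem sinIntegral_legendreDeriv_of_ne {l l' : ℕ} (h : l ≠ l') (m : ℕ) :
    sinIntegral (2 * m + 1) (legendreDeriv l m) (legendreDeriv l' m) = 0 := by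
  refine (gegenbauerEq_legendreDeriv l m).sinIntegral_eq_zero (gegenbauerEq_legendreDeriv l' m)
    fun e => h ?_
  have : ((l : ℝ) - l') * (l + l' + 1) = 0 := by linear_combination e
  rcases mul_eq_zero.1 this with h | h
  · exact_mod_cast sub_eq_zero.1 h
  · exact absurd h (by positivity)

end Gegenbauer

/-! ### The azimuthal factors -/

theorem integral_cos_int_mul (n : ℤ) :
    ∫ φ in (-Real.pi)..Real.pi, Real.cos (n * φ) = if n = 0 then 2 * Real.pi else 0 := by
  split_ifs with h
  · simp [h]; ring
  · have hn : (n : ℝ) ≠ 0 := Int.cast_ne_zero.2 h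
    rw [intervalIntegral.integral_comp_mul_left (fun x => Real.cos x) hn, integral_cos]
    simp [Real.sin_int_mul_pi]

theorem integral_sin_int_mul (n : ℤ) :
    ∫ φ in (-Real.pi)..Real.pi, Real.sin (n * φ) = 0 := by
  by_cases h : n = 0
  · simp [h]
  · have hn : (n : ℝ) ≠ 0 := Int.cast_ne_zero.2 h
    rw [intervalIntegral.integral_comp_mul_left (fun x => Real.sin x) hn, integral_sin]
    simp

theorem integral_cos_mul_cos (a b : ℤ) :
    ∫ φ in (-Real.pi)..Real.pi, Real.cos (a * φ) * Real.cos (b * φ) =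
      1 / 2 * ((if a - b = 0 then 2 * Real.pi else 0) + if a + b = 0 then 2 * Real.pi else 0) := by
  have e : ∀ φ : ℝ, Real.cos (a * φ) * Real.cos (b * φ) =
      1 / 2 * (Real.cos ((a - b : ℤ) * φ) + Real.cos ((a + b : ℤ) * φ)) := fun φ => by
    push_cast; rw [sub_mul, add_mul, Real.cos_sub, Real.cos_add]; ring
  have hc : ∀ n : ℤ, IntervalIntegrable (fun φ : ℝ => Real.cos (n * φ)) volume (-Real.pi) Real.pi :=
    fun n => Continuous.intervalIntegrable (by fun_prop) _ _
  simp only [e]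
  rw [intervalIntegral.integral_const_mul, intervalIntegral.integral_add (hc _) (hc _),
    integral_cos_int_mul, integral_cos_int_mul]

theorem integral_sin_mul_sin (a b : ℤ) :
    ∫ φ in (-Real.pi)..Real.pi, Real.sin (a * φ) * Real.sin (b * φ) =
      1 / 2 * ((if a - b = 0 then 2 * Real.pi else 0) - if a + b = 0 then 2 * Real.pi else 0) := by
  have e : ∀ φ : ℝ, Real.sin (a * φ) * Real.sin (b * φ) =
      1 / 2 * (Real.cos ((a - b : ℤ) * φ) - Real.cos ((a + b : ℤ) * φ)) := fun φ => by
    push_cast; rw [sub_mul, add_mul, Real.cos_sub, Real.cos_add]; ring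
  have hc : ∀ n : ℤ, IntervalIntegrable (fun φ : ℝ => Real.cos (n * φ)) volume (-Real.pi) Real.pi :=
    fun n => Continuous.intervalIntegrable (by fun_prop) _ _
  simp only [e]
  rw [intervalIntegral.integral_const_mul, intervalIntegral.integral_sub (hc _) (hc _),
    integral_cos_int_mul, integral_cos_int_mul]

theorem integral_sin_mul_cos (a b : ℤ) :
    ∫ φ in (-Real.pi)..Real.pi, Real.sin (a * φ) * Real.cos (b * φ) = 0 := by
  have e : ∀ φ : ℝ, Real.sin (a * φ) * Real.cos (b * φ) =
      1 / 2 * (Real.sin ((a - b : ℤ) * φ) + Real.sin ((a + b : ℤ) * φ)) := fun φ => by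
    push_cast; rw [sub_mul, add_mul, Real.sin_sub, Real.sin_add]; ring
  have hc : ∀ n : ℤ, IntervalIntegrable (fun φ : ℝ => Real.sin (n * φ)) volume (-Real.pi) Real.pi :=
    fun n => Continuous.intervalIntegrable (by fun_prop) _ _
  simp only [e]
  rw [intervalIntegral.integral_const_mul, intervalIntegral.integral_add (hc _) (hc _),
    integral_sin_int_mul, integral_sin_int_mul]
  simp

theorem azimuthal_of_nonneg {m : ℤ} (hm : 0 ≤ m) (φ : ℝ) :
    azimuthal m φ = (if m = 0 then 1 / √2 else 1) * Real.cos (m * φ) := by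
  rcases hm.eq_or_lt with h | h
  · subst h; simp [azimuthal]
  · rw [azimuthal, if_pos (by omega), if_neg (by omega), one_mul]

theorem azimuthal_of_neg {m : ℤ} (hm : m < 0) (φ : ℝ) :
    azimuthal m φ = Real.sin ((-m : ℤ) * φ) := by
  rw [azimuthal, if_neg (by omega), if_neg (by omega), abs_of_neg (by exact_mod_cast hm)]
  push_cast; rfl

theorem integral_azimuthal_mul (m m' : ℤ) :
    ∫ φ in (-Real.pi)..Real.pi, azimuthal m φ * azimuthal m' φ = if m = m' then Real.pi else 0 := by
  rcases le_or_gt 0 m with h | h <;> rcases le_or_gt 0 m' with h' | h'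
  · simp only [azimuthal_of_nonneg h, azimuthal_of_nonneg h', mul_mul_mul_comm _ (Real.cos _)]
    rw [intervalIntegral.integral_const_mul, integral_cos_mul_cos]
    by_cases e : m = m'
    · subst e
      rcases h.eq_or_lt with h0 | h0
      · subst h0
        -- For m = 0 the cosine integral is doubled, since m - m' and m + m' both vanish; the two
        -- factors 1/√2 compensate.
        have : √2 * √2 = (2 : ℝ) := Real.mul_self_sqrt (by norm_num)
        simp only [if_true, add_zero, sub_zero]
        field_simp
        rw [sq, this]; ring
      · rw [if_neg (by omega), if_pos (by omega), if_neg (by omega), if_pos rfl]; ring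
    · rw [if_neg (by omega : ¬ (m - m' = 0)), if_neg (by omega : ¬ (m + m' = 0)), if_neg e]; ring
  · simp only [azimuthal_of_nonneg h, azimuthal_of_neg h', mul_comm _ (Real.sin _),
      mul_left_comm (Real.sin _)]
    rw [intervalIntegral.integral_const_mul, integral_sin_mul_cos, mul_zero, if_neg (by omega)]
  · simp only [azimuthal_of_nonneg h', azimuthal_of_neg h, mul_left_comm (Real.sin _)]
    rw [intervalIntegral.integral_const_mul, integral_sin_mul_cos, mul_zero, if_neg (by omega)]
  · simp only [azimuthal_of_neg h, azimuthal_of_neg h']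
    rw [integral_sin_mul_sin, if_neg (by omega : ¬ (-m + -m' = 0))]
    by_cases e : m = m'
    · rw [if_pos (by omega), if_pos e]; ring
    · rw [if_neg (by omega), if_neg e]; ring

/-! ### Spherical coordinates -/

/-- The map `(r, θ, φ) ↦ (r sin θ cos φ, r sin θ sin φ, r cos θ)`. -/
noncomputable def sphericalMap (p : Fin 3 → ℝ) : Fin 3 → ℝ :=
  ![p 0 * Real.sin (p 1) * Real.cos (p 2), p 0 * Real.sin (p 1) * Real.sin (p 2),
    p 0 * Real.cos (p 1)]

/-- The factors of the domain of the spherical coordinates. -/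
noncomputable def sphericalDomain : Fin 3 → Set ℝ :=
  ![Set.Ioi 0, Set.Ioo 0 Real.pi, Set.Ioo (-Real.pi) Real.pi]

/-- The Jacobian matrix of the spherical coordinates. -/
noncomputable def sphericalJacobian (p : Fin 3 → ℝ) : Matrix (Fin 3) (Fin 3) ℝ :=
  !![Real.sin (p 1) * Real.cos (p 2), p 0 * Real.cos (p 1) * Real.cos (p 2),
      -(p 0 * Real.sin (p 1) * Real.sin (p 2));
    Real.sin (p 1) * Real.sin (p 2), p 0 * Real.cos (p 1) * Real.sin (p 2),
      p 0 * Real.sin (p 1) * Real.cos (p 2);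
    Real.cos (p 1), -(p 0 * Real.sin (p 1)), 0]

theorem hasFDerivAt_sphericalMap (p : Fin 3 → ℝ) :
    HasFDerivAt sphericalMap (LinearMap.toContinuousLinearMap
      (Matrix.toLin' (sphericalJacobian p))) p := by
  have h : ∀ i : Fin 3, HasFDerivAt (fun q : Fin 3 → ℝ => q i)
      (ContinuousLinearMap.proj i : (Fin 3 → ℝ) →L[ℝ] ℝ) p := fun i =>
    (ContinuousLinearMap.proj i : (Fin 3 → ℝ) →L[ℝ] ℝ).hasFDerivAt
  have hs := fun i => (h i).sin
  have hc := fun i => (h i).cos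
  rw [hasFDerivAt_pi']
  intro i
  fin_cases i
  · refine (((h 0).mul (hs 1)).mul (hc 2)).congr_fderiv ?_
    ext v
    simp [sphericalJacobian, dotProduct, Fin.sum_univ_three]
    ring
  · refine (((h 0).mul (hs 1)).mul (hs 2)).congr_fderiv ?_
    ext v
    simp [sphericalJacobian, dotProduct, Fin.sum_univ_three]
    ring
  · refine ((h 0).mul (hc 1)).congr_fderiv ?_
    ext v
    simp [sphericalJacobian, dotProduct, Fin.sum_univ_three]
    ring

theorem det_sphericalJacobian (p : Fin 3 → ℝ) :
    (LinearMap.toContinuousLinearMap (Matrix.toLin' (sphericalJacobian p))).det =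
      p 0 ^ 2 * Real.sin (p 1) := by
  rw [ContinuousLinearMap.det, LinearMap.coe_toContinuousLinearMap, LinearMap.det_toLin',
    Matrix.det_fin_three]
  simp [sphericalJacobian]
  have h1 := Real.sin_sq_add_cos_sq (p 1)
  have h2 := Real.sin_sq_add_cos_sq (p 2)
  linear_combination (p 0 ^ 2 * Real.sin (p 1)) * h1 + (p 0 ^ 2 * Real.sin (p 1) *
    (Real.sin (p 1) ^ 2 + Real.cos (p 1) ^ 2)) * h2

theorem mem_sphericalDomain {p : Fin 3 → ℝ} : p ∈ Set.pi Set.univ sphericalDomain ↔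
    0 < p 0 ∧ p 1 ∈ Set.Ioo 0 Real.pi ∧ p 2 ∈ Set.Ioo (-Real.pi) Real.pi := by
  simp [Set.mem_pi, Fin.forall_fin_succ, sphericalDomain]

theorem sum_sphericalMap_sq (p : Fin 3 → ℝ) :
    sphericalMap p 0 ^ 2 + sphericalMap p 1 ^ 2 + sphericalMap p 2 ^ 2 = p 0 ^ 2 := by
  have h1 := Real.sin_sq_add_cos_sq (p 1)
  have h2 := Real.sin_sq_add_cos_sq (p 2)
  simp [sphericalMap]
  linear_combination (p 0 ^ 2) * h1 + (p 0 ^ 2 * Real.sin (p 1) ^ 2) * h2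

/-- The scale c is there for the factor 2/(|x|² + 1) introduced by `invStereo`. -/
theorem arg_sphericalMap {p : Fin 3 → ℝ} (hp : p ∈ Set.pi Set.univ sphericalDomain) {c : ℝ}
    (hc : 0 < c) :
    Complex.arg ⟨c * sphericalMap p 0, c * sphericalMap p 1⟩ = p 2 := by
  obtain ⟨h0, h1, h2⟩ := mem_sphericalDomain.1 hp
  have hr : 0 < c * (p 0 * Real.sin (p 1)) :=
    mul_pos hc (mul_pos h0 (Real.sin_pos_of_mem_Ioo h1))
  rw [← Complex.arg_mul_cos_add_sin_mul_I hr ⟨h2.1, h2.2.le⟩]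
  congr 1
  apply Complex.ext <;>
    simp [sphericalMap, ← Complex.ofReal_cos, ← Complex.ofReal_sin] <;> ring

theorem injOn_sphericalMap : Set.InjOn sphericalMap (Set.pi Set.univ sphericalDomain) := by
  intro p hp q hq h
  obtain ⟨p0, p1, p2⟩ := mem_sphericalDomain.1 hp
  obtain ⟨q0, q1, q2⟩ := mem_sphericalDomain.1 hq
  have e0 : p 0 = q 0 := by
    have : p 0 ^ 2 = q 0 ^ 2 := by rw [← sum_sphericalMap_sq p, ← sum_sphericalMap_sq q, h]
    exact (pow_left_inj₀ p0.le q0.le two_ne_zero).1 this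
  have e1 : p 1 = q 1 := by
    have h2 : p 0 * Real.cos (p 1) = q 0 * Real.cos (q 1) := by
      simpa [sphericalMap] using congrFun h 2
    rw [← e0] at h2
    exact Real.injOn_cos ⟨p1.1.le, p1.2.le⟩ ⟨q1.1.le, q1.2.le⟩ (mul_left_cancel₀ p0.ne' h2)
  have e2 : p 2 = q 2 := by
    rw [← arg_sphericalMap hp one_pos, ← arg_sphericalMap hq one_pos, h]
  ext i; fin_cases i <;> assumption

/-- The points missed by the coordinates, namely the axis and the half-plane φ = π, lie in the plane
where the second coordinate vanishes, which is a null set. -/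
theorem mem_image_sphericalMap {x : Fin 3 → ℝ} (hx : x 1 ≠ 0) :
    x ∈ sphericalMap '' Set.pi Set.univ sphericalDomain := by
  have hpos : 0 < x 0 ^ 2 + x 1 ^ 2 := by positivity
  have hr2 : 0 < x 0 ^ 2 + x 1 ^ 2 + x 2 ^ 2 := by positivity
  set r := √(x 0 ^ 2 + x 1 ^ 2 + x 2 ^ 2) with hr
  have hr0 : 0 < r := Real.sqrt_pos.2 hr2
  have hrs : r ^ 2 = x 0 ^ 2 + x 1 ^ 2 + x 2 ^ 2 := Real.sq_sqrt hr2.le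
  have hlt : |x 2 / r| < 1 := by
    rw [abs_div, abs_of_pos hr0, div_lt_one hr0]
    exact abs_lt_of_sq_lt_sq (by linarith) hr0.le
  obtain ⟨hl, hu⟩ := abs_lt.1 hlt
  have hz : ‖(⟨x 0, x 1⟩ : ℂ)‖ = √(x 0 ^ 2 + x 1 ^ 2) := by
    rw [Complex.norm_eq_sqrt_sq_add_sq]
  have hsin : r * Real.sin (Real.arccos (x 2 / r)) = ‖(⟨x 0, x 1⟩ : ℂ)‖ := by
    rw [Real.sin_arccos, hz]
    nth_rewrite 1 [← Real.sqrt_sq hr0.le]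
    rw [← Real.sqrt_mul (sq_nonneg r)]
    congr 1
    field_simp
    linarith
  refine ⟨![r, Real.arccos (x 2 / r), Complex.arg ⟨x 0, x 1⟩], mem_sphericalDomain.2
    ⟨by simpa, ?_, ?_⟩, ?_⟩
  · simp only [Matrix.cons_val_one, Matrix.cons_val_zero]
    refine ⟨Real.arccos_pos.2 hu, lt_of_le_of_ne (Real.arccos_le_pi _) fun h => ?_⟩
    rw [Real.arccos_eq_pi] at h; linarith
  · simp only [Matrix.cons_val]
    refine ⟨Complex.neg_pi_lt_arg _, lt_of_le_of_ne (Complex.arg_le_pi _) fun h => ?_⟩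
    exact hx (Complex.arg_eq_pi_iff.1 h).2
  · ext i
    fin_cases i
    · simp [sphericalMap, hsin]
    · simp [sphericalMap, hsin]
    · simp only [sphericalMap, Fin.reduceFinMk, Matrix.cons_val]
      rw [Real.cos_arccos hl.le hu.le]
      field_simp

theorem integral_eq_integral_spherical (F : E3 → ℝ) :
    ∫ x, F x = ∫ p in Set.pi Set.univ sphericalDomain,
      p 0 ^ 2 * Real.sin (p 1) * F (WithLp.toLp 2 (sphericalMap p)) := by
  have hm : MeasurableSet (Set.pi Set.univ sphericalDomain) := by
    refine MeasurableSet.univ_pi fun i => ?_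
    fin_cases i
    · exact measurableSet_Ioi
    · exact measurableSet_Ioo
    · exact measurableSet_Ioo
  have h := integral_image_eq_integral_abs_det_fderiv_smul volume hm
    (fun p _ => (hasFDerivAt_sphericalMap p).hasFDerivWithinAt) injOn_sphericalMap
    (fun y => F (WithLp.toLp 2 y))
  have hae : (sphericalMap '' Set.pi Set.univ sphericalDomain : Set (Fin 3 → ℝ))
      =ᵐ[volume] Set.univ := by
    rw [ae_eq_univ]
    refine measure_mono_null (fun x hx => ?_)
      (Measure.pi_hyperplane (fun _ : Fin 3 => (volume : Measure ℝ)) 1 0)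
    by_contra h0
    exact hx (mem_image_sphericalMap h0)
  rw [setIntegral_congr_set hae, setIntegral_univ] at h
  rw [← (PiLp.volume_preserving_toLp (Fin 3)).integral_comp
    (MeasurableEquiv.toLp 2 (Fin 3 → ℝ)).measurableEmbedding F, h]
  refine setIntegral_congr_fun hm fun p hp => ?_
  obtain ⟨h0, h1, -⟩ := mem_sphericalDomain.1 hp
  simp only [det_sphericalJacobian, smul_eq_mul]
  rw [abs_of_nonneg (mul_nonneg (sq_nonneg _) (Real.sin_pos_of_mem_Ioo h1).le)]

theorem integral_eq_mul_of_spherical {F : E3 → ℝ} {A B D : ℝ → ℝ}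
    (h : ∀ p ∈ Set.pi Set.univ sphericalDomain,
      p 0 ^ 2 * Real.sin (p 1) * F (WithLp.toLp 2 (sphericalMap p)) = A (p 0) * B (p 1) * D (p 2)) :
    ∫ x, F x = (∫ r in Set.Ioi 0, A r) * (∫ θ in (0 : ℝ)..Real.pi, B θ) *
      ∫ φ in (-Real.pi)..Real.pi, D φ := by
  have hm : MeasurableSet (Set.pi Set.univ sphericalDomain) := by
    refine MeasurableSet.univ_pi fun i => ?_
    fin_cases i
    · exact measurableSet_Ioi
    · exact measurableSet_Ioo
    · exact measurableSet_Ioo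
  rw [integral_eq_integral_spherical, setIntegral_congr_fun hm h, volume_pi,
    Measure.restrict_pi_pi]
  have := integral_fintype_prod_eq_prod (𝕜 := ℝ) ![A, B, D]
    (μ := fun i => (volume : Measure ℝ).restrict (sphericalDomain i))
  simp only [Fin.prod_univ_three] at this
  rw [intervalIntegral.integral_of_le Real.pi_pos.le, intervalIntegral.integral_of_le
    (by linarith [Real.pi_pos]), integral_Ioc_eq_integral_Ioo, integral_Ioc_eq_integral_Ioo]
  exact this

/-! ### The radial variable -/

/-- Substitute r = tan((π - χ)/2) = cot(χ/2). Then (r² - 1)/(r² + 1) = cos χ, 2/(r² + 1) = 2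
sin²(χ/2), and the Jacobian turns the weight into sin² χ. -/
theorem integral_radial (g : ℝ → ℝ) :
    ∫ r in Set.Ioi (0 : ℝ), r ^ 2 * (2 / (r ^ 2 + 1)) ^ 3 *
      g (Real.arccos ((r ^ 2 - 1) / (r ^ 2 + 1))) =
    ∫ χ in (0 : ℝ)..Real.pi, Real.sin χ ^ 2 * g χ := by
  let f : ℝ → ℝ := fun χ => Real.tan ((Real.pi - χ) / 2)
  have hu : ∀ χ ∈ Set.Ioo 0 Real.pi, (Real.pi - χ) / 2 ∈ Set.Ioo 0 (Real.pi / 2) :=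
    fun χ hχ => ⟨by linarith [hχ.2], by linarith [hχ.1]⟩
  have hcos : ∀ χ ∈ Set.Ioo 0 Real.pi, 0 < Real.cos ((Real.pi - χ) / 2) := fun χ hχ =>
    Real.cos_pos_of_mem_Ioo ⟨by linarith [(hu χ hχ).1, Real.pi_pos], (hu χ hχ).2⟩
  have himg : f '' Set.Ioo 0 Real.pi = Set.Ioi 0 := by
    ext r
    constructor
    · rintro ⟨χ, hχ, rfl⟩
      exact Real.tan_pos_of_pos_of_lt_pi_div_two (hu χ hχ).1 (hu χ hχ).2
    · intro hr
      refine ⟨Real.pi - 2 * Real.arctan r, ⟨?_, ?_⟩, ?_⟩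
      · linarith [Real.arctan_lt_pi_div_two r]
      · linarith [Real.arctan_pos.2 hr]
      · simp only [f]
        rw [show (Real.pi - (Real.pi - 2 * Real.arctan r)) / 2 = Real.arctan r by ring,
          Real.tan_arctan]
  have hinj : Set.InjOn f (Set.Ioo 0 Real.pi) := by
    intro a ha b hb hab
    have := Real.injOn_tan ⟨by linarith [(hu a ha).1, Real.pi_pos], (hu a ha).2⟩
      ⟨by linarith [(hu b hb).1, Real.pi_pos], (hu b hb).2⟩ hab
    linarith
  have hder : ∀ χ ∈ Set.Ioo 0 Real.pi, HasDerivWithinAt f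
      (1 / Real.cos ((Real.pi - χ) / 2) ^ 2 * (-1 / 2)) (Set.Ioo 0 Real.pi) χ := fun χ hχ =>
    (HasDerivAt.comp (h₂ := Real.tan) (h := fun χ => (Real.pi - χ) / 2) χ
      (Real.hasDerivAt_tan (hcos χ hχ).ne')
      (((hasDerivAt_id χ).const_sub Real.pi).div_const 2)).hasDerivWithinAt
  rw [← himg, integral_image_eq_integral_abs_deriv_smul measurableSet_Ioo hder hinj,
    intervalIntegral.integral_of_le Real.pi_pos.le, integral_Ioc_eq_integral_Ioo]
  refine setIntegral_congr_fun measurableSet_Ioo fun χ hχ => ?_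
  simp only [smul_eq_mul, f]
  have hc := hcos χ hχ
  have e1 : Real.cos χ = -Real.cos (2 * ((Real.pi - χ) / 2)) := by
    rw [show 2 * ((Real.pi - χ) / 2) = Real.pi - χ by ring, Real.cos_pi_sub, neg_neg]
  have e2 : Real.sin χ = Real.sin (2 * ((Real.pi - χ) / 2)) := by
    rw [show 2 * ((Real.pi - χ) / 2) = Real.pi - χ by ring, Real.sin_pi_sub]
  have e3 : Real.arccos ((Real.tan ((Real.pi - χ) / 2) ^ 2 - 1) /
      (Real.tan ((Real.pi - χ) / 2) ^ 2 + 1)) = χ := by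
    refine Eq.trans ?_ (Real.arccos_cos hχ.1.le hχ.2.le)
    rw [e1]
    congr 1
    have hs := Real.sin_sq_add_cos_sq ((Real.pi - χ) / 2)
    rw [Real.cos_two_mul, Real.tan_eq_sin_div_cos]
    field_simp
    rw [hs]
    linear_combination hs
  rw [e3, e2, Real.sin_two_mul, Real.tan_eq_sin_div_cos, abs_mul, abs_of_pos (by positivity)]
  have hs := Real.sin_sq_add_cos_sq ((Real.pi - χ) / 2)
  generalize Real.sin ((Real.pi - χ) / 2) = s at *
  generalize Real.cos ((Real.pi - χ) / 2) = c at *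
  have e4 : (s / c) ^ 2 + 1 = 1 / c ^ 2 := by field_simp; exact hs
  rw [e4]
  norm_num
  field_simp

/-! ### Orthonormality of the Arar-Boulmezaoud functions -/

theorem sin_arccos_stereo {r : ℝ} (hr : 0 ≤ r) :
    Real.sin (Real.arccos ((r ^ 2 - 1) / (r ^ 2 + 1))) = 2 * r / (r ^ 2 + 1) := by
  rw [Real.sin_arccos, ← Real.sqrt_sq (show 0 ≤ 2 * r / (r ^ 2 + 1) by positivity)]
  congr 1
  field_simp
  ring

theorem cos_arccos_stereo (r : ℝ) :
    Real.cos (Real.arccos ((r ^ 2 - 1) / (r ^ 2 + 1))) = (r ^ 2 - 1) / (r ^ 2 + 1) := by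
  have h : 0 < r ^ 2 + 1 := by positivity
  refine Real.cos_arccos ?_ ?_
  · rw [le_div_iff₀ h]; nlinarith [sq_nonneg r]
  · rw [div_le_iff₀ h]; linarith

theorem angleChi_invStereo (x : E3) :
    angleChi (invStereo x) = Real.arccos ((‖x‖ ^ 2 - 1) / (‖x‖ ^ 2 + 1)) := by
  simp [angleChi, invStereo]

theorem ararBoul_spherical (α : ℕ × ℕ × ℤ) {p : Fin 3 → ℝ}
    (hp : p ∈ Set.pi Set.univ sphericalDomain) :
    ararBoul α (WithLp.toLp 2 (sphericalMap p)) = √(2 / (p 0 ^ 2 + 1)) *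
      harmonicCoord α (p 2) (p 1) (Real.arccos ((p 0 ^ 2 - 1) / (p 0 ^ 2 + 1))) := by
  obtain ⟨h0, h1, -⟩ := mem_sphericalDomain.1 hp
  have hn : ‖(WithLp.toLp 2 (sphericalMap p) : E3)‖ ^ 2 = p 0 ^ 2 := by
    rw [← sum_coord_sq, Fin.sum_univ_three, ← sum_sphericalMap_sq p]
  have hphi : anglePhi (invStereo (WithLp.toLp 2 (sphericalMap p))) = p 2 := by
    rw [← arg_sphericalMap hp (show 0 < 2 / (p 0 ^ 2 + 1) by positivity), anglePhi]
    simp only [invStereo, hn]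
    congr 2 <;> simp <;> ring
  have htheta : angleTheta (invStereo (WithLp.toLp 2 (sphericalMap p))) = p 1 := by
    rw [angleTheta, angleChi_invStereo, hn, sin_arccos_stereo h0.le]
    have : (invStereo (WithLp.toLp 2 (sphericalMap p))) 2 / (2 * p 0 / (p 0 ^ 2 + 1)) =
        Real.cos (p 1) := by
      have h2 : sphericalMap p 2 = p 0 * Real.cos (p 1) := rfl
      simp only [invStereo, hn, h2, Matrix.cons_val]
      field_simp
    rw [this, Real.arccos_cos h1.1.le h1.2.le]
  rw [ararBoul, harmonicS3, hphi, htheta, angleChi_invStereo, hn]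

/-- The two signs (-1)^m cancel, and the real power (1 - cos² θ)^{m/2} is sin^m θ because the sine
is nonnegative. -/
theorem legendreK_cos {l m : ℕ} {θ : ℝ} (hθ : 0 ≤ Real.sin θ) :
    legendreK l m (Real.cos θ) = √(((l - m).factorial : ℝ) / ((l + m).factorial : ℝ)) /
      (2 ^ l * l.factorial) * (Real.sin θ ^ m * (legendreDeriv l m).eval (Real.cos θ)) := by
  have h2 : 1 - Real.cos θ ^ 2 = Real.sin θ ^ 2 := by rw [← Real.sin_sq_add_cos_sq θ]; ring
  have h3 : (Real.sin θ ^ 2) ^ ((m : ℝ) / 2) = Real.sin θ ^ m := by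
    rw [← Real.rpow_natCast (Real.sin θ) 2, ← Real.rpow_mul hθ, ← Real.rpow_natCast]
    congr 1; push_cast; ring
  have h4 : (-1 : ℝ) ^ m * (-1) ^ m = 1 := by rw [← mul_pow]; simp
  rw [legendreK, assocLegendre, h2, h3, legendreDeriv]
  linear_combination (√(((l - m).factorial : ℝ) / ((l + m).factorial : ℝ)) /
      (2 ^ l * l.factorial) * (Real.sin θ ^ m * (Polynomial.derivative^[l + m]
      ((Polynomial.X ^ 2 - 1) ^ l : Polynomial ℝ)).eval (Real.cos θ))) * h4

theorem integral_legendreK {l l' m : ℕ} (hm : m ≤ l) :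
    ∫ θ in (0 : ℝ)..Real.pi, Real.sin θ * (legendreK l m (Real.cos θ) *
      legendreK l' m (Real.cos θ)) = if l = l' then 2 / (2 * (l : ℝ) + 1) else 0 := by
  set c : ℕ → ℝ := fun l => √(((l - m).factorial : ℝ) / ((l + m).factorial : ℝ)) /
      (2 ^ l * l.factorial) with hc
  have h : ∫ θ in (0 : ℝ)..Real.pi, Real.sin θ * (legendreK l m (Real.cos θ) *
      legendreK l' m (Real.cos θ)) =
      c l * c l' * sinIntegral (2 * m + 1) (legendreDeriv l m) (legendreDeriv l' m) := by
    rw [sinIntegral, ← intervalIntegral.integral_const_mul]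
    refine intervalIntegral.integral_congr fun θ hθ => ?_
    rw [Set.uIcc_of_le Real.pi_pos.le] at hθ
    have hs := Real.sin_nonneg_of_mem_Icc hθ
    simp only [legendreK_cos hs, hc]
    ring
  rw [h]
  split_ifs with e
  · subst e
    have h1 : c l * c l = ((l - m).factorial : ℝ) / ((l + m).factorial : ℝ) /
        (2 ^ l * l.factorial) ^ 2 := by
      rw [← sq, hc, div_pow, Real.sq_sqrt (by positivity)]
    rw [h1, sinIntegral_legendreDeriv_self l m hm]
    have := Nat.factorial_ne_zero (l - m)
    have := Nat.factorial_ne_zero (l + m)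
    have := Nat.factorial_ne_zero l
    field_simp
  · rw [sinIntegral_legendreDeriv_of_ne e, mul_zero]

theorem normConst_pos (k l : ℕ) : 0 < normConst k l := by
  rw [normConst]
  have := Real.pi_pos
  positivity

/-- The factor of `harmonicCoord` that depends on `χ`. -/
noncomputable def chiFactor (k l : ℕ) (χ : ℝ) : ℝ :=
  1 / √(normConst k l) * Real.sin χ ^ l *
    (Polynomial.derivative^[l + 1] (Polynomial.Chebyshev.T ℝ ((k : ℤ) + 1))).eval (Real.cos χ)

theorem integral_chiFactor {k k' l : ℕ} (hl : l ≤ k) :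
    ∫ χ in (0 : ℝ)..Real.pi, Real.sin χ ^ 2 * (chiFactor k l χ * chiFactor k' l χ) =
      if k = k' then 1 else 0 := by
  have h : ∫ χ in (0 : ℝ)..Real.pi, Real.sin χ ^ 2 * (chiFactor k l χ * chiFactor k' l χ) =
      1 / √(normConst k l) * (1 / √(normConst k' l)) * sinIntegral (2 * (l + 1))
        (Polynomial.derivative^[l + 1] (Polynomial.Chebyshev.T ℝ ((k : ℤ) + 1)))
        (Polynomial.derivative^[l + 1] (Polynomial.Chebyshev.T ℝ ((k' : ℤ) + 1))) := by
    rw [sinIntegral, ← intervalIntegral.integral_const_mul]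
    refine intervalIntegral.integral_congr fun χ _ => ?_
    simp only [chiFactor]
    ring
  rw [h]
  split_ifs with e
  · subst e
    have hp := normConst_pos k l
    have hq := Real.sqrt_pos.2 hp
    rw [sinIntegral_T_self k l hl]
    nth_rewrite 3 [← Real.mul_self_sqrt hp.le]
    field_simp
  · rw [sinIntegral_T_of_ne e, mul_zero]

theorem harmonicCoord_eq (k l : ℕ) (m : ℤ) (φ θ χ : ℝ) :
    harmonicCoord (k, l, m) φ θ χ = chiFactor k l χ *
      (√((2 * (l : ℝ) + 1) / (2 * Real.pi)) * legendreK l m.natAbs (Real.cos θ)) *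
        azimuthal m φ := by
  simp only [harmonicCoord, chiFactor, sphericalY]
  ring

/-- The Arar-Boulmezaoud functions are orthonormal for the weight `4 / (|x|² + 1)²`. -/
theorem integral_ararBoul_mul {k k' l l' : ℕ} {m m' : ℤ} (hl : l ≤ k) (hm : m.natAbs ≤ l) :
    ∫ x, 4 / (‖x‖ ^ 2 + 1) ^ 2 * ararBoul (k, l, m) x * ararBoul (k', l', m') x =
      if (k, l, m) = (k', l', m') then 1 else 0 := by
  set c : ℕ → ℝ := fun l => √((2 * (l : ℝ) + 1) / (2 * Real.pi)) with hc
  have h := integral_eq_mul_of_spherical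
    (F := fun x => 4 / (‖x‖ ^ 2 + 1) ^ 2 * ararBoul (k, l, m) x * ararBoul (k', l', m') x)
    (A := fun r => r ^ 2 * (2 / (r ^ 2 + 1)) ^ 3 *
      (fun χ => chiFactor k l χ * chiFactor k' l' χ) (Real.arccos ((r ^ 2 - 1) / (r ^ 2 + 1))))
    (B := fun θ => c l * c l' * (Real.sin θ * (legendreK l m.natAbs (Real.cos θ) *
      legendreK l' m'.natAbs (Real.cos θ))))
    (D := fun φ => azimuthal m φ * azimuthal m' φ) (fun p hp => by
      have hn : ‖(WithLp.toLp 2 (sphericalMap p) : E3)‖ ^ 2 = p 0 ^ 2 := by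
        rw [← sum_coord_sq, Fin.sum_univ_three, ← sum_sphericalMap_sq p]
      simp only [ararBoul_spherical _ hp, harmonicCoord_eq, hn, hc]
      have hs : √(2 / (p 0 ^ 2 + 1)) ^ 2 = 2 / (p 0 ^ 2 + 1) := Real.sq_sqrt (by positivity)
      have h4 : 4 / (p 0 ^ 2 + 1) ^ 2 = (2 / (p 0 ^ 2 + 1)) ^ 2 := by rw [div_pow]; norm_num
      -- The weight (2/(r² + 1))² and the two square-root prefactors combine into (2/(r² + 1))³, the
      -- volume density of the stereographic projection.
      rw [h4]
      generalize 2 / (p 0 ^ 2 + 1) = w at *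
      generalize Real.arccos ((p 0 ^ 2 - 1) / (p 0 ^ 2 + 1)) = χ
      linear_combination (p 0 ^ 2 * Real.sin (p 1) * w ^ 2 * chiFactor k l χ * chiFactor k' l' χ *
        √((2 * (l : ℝ) + 1) / (2 * Real.pi)) * √((2 * (l' : ℝ) + 1) / (2 * Real.pi)) *
        legendreK l m.natAbs (Real.cos (p 1)) * legendreK l' m'.natAbs (Real.cos (p 1)) *
        azimuthal m (p 2) * azimuthal m' (p 2)) * hs)
  rw [h, integral_radial fun χ => chiFactor k l χ * chiFactor k' l' χ, integral_azimuthal_mul, intervalIntegral.integral_const_mul]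
  by_cases em : m = m'
  · subst em
    rw [integral_legendreK hm]
    by_cases el : l = l'
    · subst el
      rw [integral_chiFactor hl]
      have h1 : c l * c l = (2 * (l : ℝ) + 1) / (2 * Real.pi) := by
        have := Real.pi_pos
        rw [hc]; exact Real.mul_self_sqrt (by positivity)
      have := Real.pi_pos
      rw [h1, if_pos rfl, if_pos rfl]
      by_cases ek : k = k'
      · subst ek
        simp only [if_true]
        field_simp
      · rw [if_neg ek, if_neg (show ¬ (k, l, m) = (k', l, m) by simp [ek])]; ring
    · rw [if_neg el, if_neg (show ¬ (k, l, m) = (k', l', m) by simp [el])]; ring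
  · rw [if_neg em, if_neg (show ¬ (k, l, m) = (k', l', m') by simp [em])]; ring

/-! ### The Arar-Boulmezaoud functions belong to the discrete spaces -/

/-- `f` is given by a real polynomial of degree at most `n`. -/
def IsPolynomialOfDegreeLE (n : ℕ) (f : E3 → ℝ) : Prop :=
  ∃ p : MvPolynomial (Fin 3) ℝ, p.totalDegree ≤ n ∧ ∀ x : E3, f x = MvPolynomial.eval (⇑x) p

namespace IsPolynomialOfDegreeLE

theorem mono {m n : ℕ} (h : m ≤ n) {f : E3 → ℝ} (hf : IsPolynomialOfDegreeLE m f) :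
    IsPolynomialOfDegreeLE n f := by
  obtain ⟨p, hp, e⟩ := hf
  exact ⟨p, hp.trans h, e⟩

theorem const (c : ℝ) : IsPolynomialOfDegreeLE 0 fun _ => c :=
  ⟨MvPolynomial.C c, by simp, by simp⟩

theorem coord (i : Fin 3) : IsPolynomialOfDegreeLE 1 fun x => x i :=
  ⟨MvPolynomial.X i, by simp, by simp⟩

theorem mul {m n : ℕ} {f g : E3 → ℝ} (hf : IsPolynomialOfDegreeLE m f)
    (hg : IsPolynomialOfDegreeLE n g) : IsPolynomialOfDegreeLE (m + n) fun x => f x * g x := by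
  obtain ⟨p, hp, e⟩ := hf
  obtain ⟨q, hq, e'⟩ := hg
  exact ⟨p * q, (MvPolynomial.totalDegree_mul p q).trans (add_le_add hp hq), by simp [e, e']⟩

theorem add {n : ℕ} {f g : E3 → ℝ} (hf : IsPolynomialOfDegreeLE n f)
    (hg : IsPolynomialOfDegreeLE n g) : IsPolynomialOfDegreeLE n fun x => f x + g x := by
  obtain ⟨p, hp, e⟩ := hf
  obtain ⟨q, hq, e'⟩ := hg
  exact ⟨p + q, (MvPolynomial.totalDegree_add p q).trans (max_le hp hq), by simp [e, e']⟩

theorem const_mul {n : ℕ} {f : E3 → ℝ} (hf : IsPolynomialOfDegreeLE n f) (c : ℝ) :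
    IsPolynomialOfDegreeLE n fun x => c * f x :=
  ((const c).mul hf).mono (by omega)

theorem pow {n : ℕ} {f : E3 → ℝ} (hf : IsPolynomialOfDegreeLE n f) (k : ℕ) :
    IsPolynomialOfDegreeLE (k * n) fun x => f x ^ k := by
  induction k with
  | zero => simpa using const 1
  | succ k ih => simpa only [pow_succ, add_mul, one_mul] using ih.mul hf

theorem sum {ι : Type*} (s : Finset ι) {n : ℕ} {f : ι → E3 → ℝ}
    (hf : ∀ i ∈ s, IsPolynomialOfDegreeLE n (f i)) :
    IsPolynomialOfDegreeLE n fun x => ∑ i ∈ s, f i x := by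
  classical
  induction s using Finset.induction_on with
  | empty => simpa using (const 0).mono (Nat.zero_le n)
  | insert a s ha ih =>
    simp only [Finset.sum_insert ha]
    exact (hf a (Finset.mem_insert_self a s)).add
      (ih fun i hi => hf i (Finset.mem_insert_of_mem hi))

theorem normSq : IsPolynomialOfDegreeLE 2 fun x => ‖x‖ ^ 2 := by
  simp only [← sum_coord_sq]
  exact sum _ fun i _ => (coord i).pow 2

theorem div_mem_wmonoSpan {n j N : ℕ} {f : E3 → ℝ} (hf : IsPolynomialOfDegreeLE n f) (hn : n ≤ j)
    (hj : j < N) : (fun x => f x / (‖x‖ ^ 2 + 1) ^ ((j : ℝ) + 1 / 2)) ∈ wmonoSpan N := by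
  obtain ⟨p, hp, e⟩ := hf
  have h : (fun x => f x / (‖x‖ ^ 2 + 1) ^ ((j : ℝ) + 1 / 2)) = ∑ d ∈ p.support,
      p.coeff d • wmono (⇑d) ((j : ℝ) + 1 / 2) := by
    ext x
    rw [e, MvPolynomial.eval_eq', Finset.sum_apply, Finset.sum_div]
    refine Finset.sum_congr rfl fun d _ => ?_
    rw [Pi.smul_apply, smul_eq_mul, wmono, Real.rpow_neg (normSq_add_one_pos x).le]
    ring
  rw [h]
  refine Submodule.sum_mem _ fun d hd => Submodule.smul_mem _ _ (wmono_mem_wmonoSpan ?_ hj rfl)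
  have := MvPolynomial.le_totalDegree hd
  rw [Finsupp.sum_fintype _ _ fun _ => rfl] at this
  exact this.trans (hp.trans hn)

theorem re_im_pow (n : ℕ) :
    IsPolynomialOfDegreeLE n (fun x => ((⟨x 0, x 1⟩ : ℂ) ^ n).re) ∧
      IsPolynomialOfDegreeLE n (fun x => ((⟨x 0, x 1⟩ : ℂ) ^ n).im) := by
  induction n with
  | zero => exact ⟨by simpa using const 1, by simpa using const 0⟩
  | succ n ih =>
    constructor
    · have := (ih.1.mul (coord 0)).add ((ih.2.mul (coord 1)).const_mul (-1))
      simpa [pow_succ, sub_eq_add_neg] using this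
    · simpa [pow_succ] using (ih.1.mul (coord 1)).add (ih.2.mul (coord 0))

end IsPolynomialOfDegreeLE

/-- The polynomial `|w|^{|m|} y_m(arg w)` of `w = x₁ + i x₂`. -/
noncomputable def azimuthalPoly (m : ℤ) (x : E3) : ℝ :=
  if 0 ≤ m then (if m = 0 then 1 / √2 else 1) * ((⟨x 0, x 1⟩ : ℂ) ^ m.natAbs).re
  else ((⟨x 0, x 1⟩ : ℂ) ^ m.natAbs).im

theorem isPolynomial_azimuthalPoly (m : ℤ) :
    IsPolynomialOfDegreeLE m.natAbs (azimuthalPoly m) := by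
  unfold azimuthalPoly
  split_ifs
  · exact (IsPolynomialOfDegreeLE.re_im_pow _).1.const_mul _
  · exact (IsPolynomialOfDegreeLE.re_im_pow _).1.const_mul _
  · exact (IsPolynomialOfDegreeLE.re_im_pow _).2

theorem complex_pow_eq (w : ℂ) (n : ℕ) :
    w ^ n = ⟨‖w‖ ^ n * Real.cos (n * w.arg), ‖w‖ ^ n * Real.sin (n * w.arg)⟩ := by
  conv_lhs => rw [← Complex.norm_mul_cos_add_sin_mul_I w, mul_pow, Complex.cos_add_sin_mul_I_pow]
  have e : (n : ℂ) * (w.arg : ℂ) = ((n * w.arg : ℝ) : ℂ) := by push_cast; rfl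
  rw [e, ← Complex.ofReal_cos, ← Complex.ofReal_sin, ← Complex.ofReal_pow]
  apply Complex.ext <;>
    simp only [Complex.re_ofReal_mul, Complex.im_ofReal_mul, Complex.add_re, Complex.add_im,
      Complex.ofReal_re, Complex.ofReal_im, Complex.I_re, Complex.I_im] <;> ring

/-- De Moivre's formula applied to x₁ + i x₂. -/
theorem azimuthalPoly_eq (m : ℤ) (x : E3) :
    azimuthalPoly m x = ‖(⟨x 0, x 1⟩ : ℂ)‖ ^ m.natAbs *
      azimuthal m (Complex.arg ⟨x 0, x 1⟩) := by
  rw [azimuthalPoly, complex_pow_eq]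
  split_ifs with h h0
  · rw [azimuthal_of_nonneg h, if_pos h0]
    subst h0; simp
  · rw [azimuthal_of_nonneg h, if_neg h0, one_mul, one_mul]
    have : (m.natAbs : ℝ) = m := by rw [← Int.cast_natCast, Int.natAbs_of_nonneg h]
    rw [this]
  · rw [azimuthal_of_neg (not_le.1 h)]
    have : (m.natAbs : ℝ) = (-m : ℤ) := by
      rw [← Int.cast_natCast, Int.ofNat_natAbs_of_nonpos (not_le.1 h).le]
    rw [this]

/-! ### Solid harmonics and the radial factor -/

/-- The homogenization `r^{l-m} D(x₃ / r)` of `D = legendreDeriv l m`. -/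
noncomputable def legendrePoly (l m : ℕ) (x : E3) : ℝ :=
  ∑ i ∈ Finset.range (l + 1), ((-1) ^ (l - i) * (l.choose i : ℝ) *
    ((2 * i).descFactorial (l + m) : ℝ)) * (x 2 ^ (2 * i - (l + m)) * (‖x‖ ^ 2) ^ (l - i))

theorem isPolynomial_legendrePoly (l m : ℕ) :
    IsPolynomialOfDegreeLE (l - m) (legendrePoly l m) := by
  refine IsPolynomialOfDegreeLE.sum _ fun i hi => ?_
  have hi := Finset.mem_range.1 hi
  -- For these i the falling factorial is zero, so the truncated exponent 2i - (l + m) is harmless.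
  by_cases h : 2 * i < l + m
  · simpa [Nat.descFactorial_eq_zero_iff_lt.2 h] using
      (IsPolynomialOfDegreeLE.const 0).mono (Nat.zero_le (l - m))
  · exact ((((IsPolynomialOfDegreeLE.coord 2).pow _).mul
      (IsPolynomialOfDegreeLE.normSq.pow _)).mono (by omega)).const_mul _

theorem eval_legendreDeriv (l m : ℕ) (t : ℝ) : (legendreDeriv l m).eval t =
    ∑ i ∈ Finset.range (l + 1), ((-1) ^ (l - i) * (l.choose i : ℝ) *
      ((2 * i).descFactorial (l + m) : ℝ)) * t ^ (2 * i - (l + m)) := by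
  have h : ((Polynomial.X ^ 2 - 1) ^ l : Polynomial ℝ) = ∑ i ∈ Finset.range (l + 1),
      Polynomial.C ((-1) ^ (l - i) * (l.choose i : ℝ)) * Polynomial.X ^ (2 * i) := by
    rw [sub_eq_add_neg, add_pow]
    refine Finset.sum_congr rfl fun i _ => ?_
    simp [pow_mul]
    ring
  rw [legendreDeriv, h, Polynomial.iterate_derivative_sum, Polynomial.eval_finsetSum]
  refine Finset.sum_congr rfl fun i _ => ?_
  rw [Polynomial.iterate_derivative_C_mul, Polynomial.iterate_derivative_X_pow_eq_natCast_mul]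
  simp
  ring

theorem legendrePoly_eq {l m : ℕ} (hm : m ≤ l) {x : E3} {t : ℝ} (h : x 2 = ‖x‖ * t) :
    legendrePoly l m x = ‖x‖ ^ (l - m) * (legendreDeriv l m).eval t := by
  rw [eval_legendreDeriv, legendrePoly, Finset.mul_sum]
  refine Finset.sum_congr rfl fun i hi => ?_
  have hi := Finset.mem_range.1 hi
  by_cases hlt : 2 * i < l + m
  · simp [Nat.descFactorial_eq_zero_iff_lt.2 hlt]
  · have e : l - m = 2 * i - (l + m) + 2 * (l - i) := by omega
    rw [h, mul_pow, e, pow_add, pow_mul ‖x‖ 2 (l - i)]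
    ring

/-- The solid harmonic `r^l K_l^{|m|}(cos θ) y_m(φ)`. -/
noncomputable def solidHarmonic (l : ℕ) (m : ℤ) (x : E3) : ℝ :=
  √(((l - m.natAbs).factorial : ℝ) / ((l + m.natAbs).factorial : ℝ)) / (2 ^ l * l.factorial) *
    (azimuthalPoly m x * legendrePoly l m.natAbs x)

theorem isPolynomial_solidHarmonic {l : ℕ} {m : ℤ} (hm : m.natAbs ≤ l) :
    IsPolynomialOfDegreeLE l (solidHarmonic l m) :=
  (((isPolynomial_azimuthalPoly m).mul (isPolynomial_legendrePoly l m.natAbs)).mono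
    (by omega)).const_mul _

theorem anglePhi_invStereo (x : E3) : anglePhi (invStereo x) = Complex.arg ⟨x 0, x 1⟩ := by
  have h : 0 < 2 / (‖x‖ ^ 2 + 1) := by positivity
  refine Eq.trans ?_ (Complex.arg_real_mul _ h)
  rw [anglePhi]
  congr 1
  apply Complex.ext <;> simp [invStereo, - Complex.ofReal_div] <;> ring

theorem angleTheta_invStereo {x : E3} (hx : 0 < ‖x‖) :
    angleTheta (invStereo x) = Real.arccos (x 2 / ‖x‖) := by
  rw [angleTheta, angleChi_invStereo, sin_arccos_stereo hx.le]
  congr 1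
  simp only [invStereo, Matrix.cons_val]
  field_simp

/-- At x = 0 the angle is a convention, but both sides vanish, so no point has to be excluded. -/
theorem norm_mul_cos_angleTheta (x : E3) : x 2 = ‖x‖ * Real.cos (angleTheta (invStereo x)) := by
  rcases (norm_nonneg x).eq_or_lt with h | h
  · have : x = 0 := norm_eq_zero.1 h.symm
    simp [this]
  · have hle : |x 2 / ‖x‖| ≤ 1 := by
      rw [abs_div, abs_norm, div_le_one h, ← Real.norm_eq_abs]
      exact PiLp.norm_apply_le x 2
    rw [angleTheta_invStereo h, Real.cos_arccos (abs_le.1 hle).1 (abs_le.1 hle).2]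
    field_simp

theorem norm_mul_sin_angleTheta (x : E3) :
    ‖x‖ * Real.sin (angleTheta (invStereo x)) = ‖(⟨x 0, x 1⟩ : ℂ)‖ := by
  have hs : 0 ≤ Real.sin (angleTheta (invStereo x)) :=
    Real.sin_nonneg_of_nonneg_of_le_pi (Real.arccos_nonneg _) (Real.arccos_le_pi _)
  have h1 := norm_mul_cos_angleTheta x
  have h2 := Real.sin_sq_add_cos_sq (angleTheta (invStereo x))
  have h3 := sum_coord_sq x
  rw [Fin.sum_univ_three] at h3
  rw [Complex.norm_eq_sqrt_sq_add_sq, ← Real.sqrt_sq (mul_nonneg (norm_nonneg x) hs)]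
  congr 1
  rw [mul_pow]
  linear_combination ‖x‖ ^ 2 * h2 - h3 + (x 2 + ‖x‖ * Real.cos (angleTheta (invStereo x))) * h1

/-- Of the factor r^l, the part r^{|m|} joins sin^{|m|} θ to form |x₁ + i x₂|^{|m|}, and the part
r^{l-|m|} homogenizes the Legendre factor. -/
theorem norm_pow_mul_sphericalY {l : ℕ} {m : ℤ} (hm : m.natAbs ≤ l) (x : E3) :
    ‖x‖ ^ l * (legendreK l m.natAbs (Real.cos (angleTheta (invStereo x))) *
      azimuthal m (anglePhi (invStereo x))) = solidHarmonic l m x := by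
  have hs : 0 ≤ Real.sin (angleTheta (invStereo x)) :=
    Real.sin_nonneg_of_nonneg_of_le_pi (Real.arccos_nonneg _) (Real.arccos_le_pi _)
  rw [solidHarmonic, legendreK_cos hs, anglePhi_invStereo, azimuthalPoly_eq,
    legendrePoly_eq hm (norm_mul_cos_angleTheta x), ← norm_mul_sin_angleTheta, mul_pow]
  obtain ⟨c, hc⟩ := Nat.exists_eq_add_of_le hm
  have e : ‖x‖ ^ l = ‖x‖ ^ m.natAbs * ‖x‖ ^ (l - m.natAbs) := by rw [← pow_add]; congr 1; omega
  rw [e]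
  ring

/-- The polynomial in `1 / (|x|² + 1)` that gives the `χ`-dependence of `ararBoul (k, l, m)`. -/
noncomputable def radialPoly (k l : ℕ) : Polynomial ℝ :=
  (Polynomial.derivative^[l + 1] (Polynomial.Chebyshev.T ℝ ((k : ℤ) + 1))).comp
    (1 - Polynomial.C 2 * Polynomial.X)

theorem natDegree_radialPoly_le (k l : ℕ) : (radialPoly k l).natDegree ≤ k - l := by
  have h1 := Polynomial.natDegree_iterate_derivative
    (Polynomial.Chebyshev.T ℝ ((k : ℤ) + 1)) (l + 1)
  rw [Polynomial.Chebyshev.natDegree_T] at h1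
  have h2 : (1 - Polynomial.C 2 * Polynomial.X : Polynomial ℝ).natDegree ≤ 1 := by
    compute_degree
  refine Polynomial.natDegree_comp_le.trans ?_
  refine (Nat.mul_le_mul h1 h2).trans ?_
  omega

/-- Since sin χ = 2r/(r² + 1), the factor sin^l χ supplies the r^l of the solid harmonic; since cos
χ = 1 - 2/(r² + 1), the Chebyshev factor is a polynomial in 1/(r² + 1) of degree at most k - l. Each
term has numerator degree at most l ≤ l + j, with l + j ≤ k. -/
theorem ararBoul_eq {k l : ℕ} {m : ℤ} (hm : m.natAbs ≤ l) (x : E3) :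
    ararBoul (k, l, m) x = ∑ j ∈ Finset.range (k - l + 1),
      (√2 * 2 ^ l / √(normConst k l) * √((2 * (l : ℝ) + 1) / (2 * Real.pi)) *
        (radialPoly k l).coeff j) *
        (solidHarmonic l m x / (‖x‖ ^ 2 + 1) ^ (((l + j : ℕ) : ℝ) + 1 / 2)) := by
  have hs := normSq_add_one_pos x
  have hQ : (Polynomial.derivative^[l + 1] (Polynomial.Chebyshev.T ℝ ((k : ℤ) + 1))).eval
      ((‖x‖ ^ 2 - 1) / (‖x‖ ^ 2 + 1)) =
      ∑ j ∈ Finset.range (k - l + 1), (radialPoly k l).coeff j * (‖x‖ ^ 2 + 1)⁻¹ ^ j := by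
    rw [← Polynomial.eval_eq_sum_range' (Nat.lt_succ_of_le (natDegree_radialPoly_le k l)),
      radialPoly, Polynomial.eval_comp]
    congr 1
    simp
    field_simp
    ring
  have hr : ∀ j : ℕ, (‖x‖ ^ 2 + 1) ^ (((l + j : ℕ) : ℝ) + 1 / 2) =
      (‖x‖ ^ 2 + 1) ^ l * (‖x‖ ^ 2 + 1) ^ j * √(‖x‖ ^ 2 + 1) := fun j => by
    rw [Real.rpow_add hs, Real.rpow_natCast, pow_add, Real.sqrt_eq_rpow]
  rw [ararBoul, harmonicS3, harmonicCoord_eq, chiFactor, angleChi_invStereo,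
    sin_arccos_stereo (norm_nonneg x), cos_arccos_stereo, hQ, ← norm_pow_mul_sphericalY hm,
    Real.sqrt_div zero_le_two, div_pow, mul_pow, Finset.mul_sum, Finset.sum_mul, Finset.sum_mul,
    Finset.mul_sum]
  refine Finset.sum_congr rfl fun j _ => ?_
  rw [hr, inv_pow]
  have := Real.sqrt_pos.2 hs
  field_simp

theorem ararBoul_mem_wmonoSpan {k l n : ℕ} {m : ℤ} (hl : l ≤ k) (hm : m.natAbs ≤ l) (hk : k < n) :
    ararBoul (k, l, m) ∈ wmonoSpan n := by
  have e : ararBoul (k, l, m) = ∑ j ∈ Finset.range (k - l + 1),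
      (√2 * 2 ^ l / √(normConst k l) * √((2 * (l : ℝ) + 1) / (2 * Real.pi)) *
        (radialPoly k l).coeff j) •
        fun x : E3 => solidHarmonic l m x / (‖x‖ ^ 2 + 1) ^ (((l + j : ℕ) : ℝ) + 1 / 2) := by
    ext x
    rw [ararBoul_eq hm, Finset.sum_apply]
    rfl
  rw [e]
  refine Submodule.sum_mem _ fun j hj => Submodule.smul_mem _ _
    ((isPolynomial_solidHarmonic hm).div_mem_wmonoSpan (Nat.le_add_right l j) ?_)
  have := Finset.mem_range.1 hj
  omega

/-! ### The Arar-Boulmezaoud functions span the discrete spaces -/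

/-- The indices `(k, l, m)` of level `k < n`. -/
noncomputable def indexBelow (n : ℕ) : Finset (ℕ × ℕ × ℤ) := (Finset.range n).biUnion indexLevel

theorem mem_indexBelow {n k l : ℕ} {m : ℤ} :
    (k, l, m) ∈ indexBelow n ↔ k < n ∧ l ≤ k ∧ m.natAbs ≤ l := by
  simp only [indexBelow, Finset.mem_biUnion, Finset.mem_range, mem_indexLevel]
  constructor
  · rintro ⟨i, hi, rfl, hl, h⟩; omega
  · rintro ⟨hk, hl, h⟩; exact ⟨k, hk, rfl, hl, by omega⟩

theorem sum_indexBelow (n : ℕ) (f : ℕ × ℕ × ℤ → ℝ) :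
    ∑ α ∈ indexBelow n, f α = ∑ k ∈ Finset.range n, ∑ α ∈ indexLevel k, f α := by
  refine Finset.sum_biUnion fun i _ j _ hij => Finset.disjoint_left.2 ?_
  rintro ⟨k, l, m⟩ h h'
  rw [mem_indexLevel] at h h'
  exact hij (h.1.symm.trans h'.1)

/-- The 2l + 1 values of m sum over l ≤ k to (k+1)². Only this lower bound is needed to meet
`finrank_wmonoSpan_le`. -/
theorem le_card_indexBelow (n : ℕ) :
    ∑ k ∈ Finset.range n, (k + 1) ^ 2 ≤ (indexBelow n).card := by
  let s : Finset (Σ _ : ℕ, Σ _ : ℕ, ℤ) := (Finset.range n).sigma fun k =>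
    (Finset.range (k + 1)).sigma fun l => Finset.Icc (-(l : ℤ)) l
  have hs : s.card = ∑ k ∈ Finset.range n, (k + 1) ^ 2 := by
    have h2 : ∀ k : ℕ, ∑ l ∈ Finset.range k, ((l : ℤ) + 1 - -(l : ℤ)).toNat = k ^ 2 := by
      intro k
      induction k with
      | zero => simp
      | succ k ih =>
        rw [Finset.sum_range_succ, ih]
        have : ((k : ℤ) + 1 - -(k : ℤ)).toNat = 2 * k + 1 := by omega
        rw [this]; ring
    simp only [s, Finset.card_sigma, Int.card_Icc, h2]
  rw [← hs]
  refine Finset.card_le_card_of_injOn (fun i => (i.1, i.2.1, i.2.2)) ?_ ?_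
  · rintro ⟨k, l, m⟩ h
    simp only [s, Finset.coe_sigma, Set.mem_sigma_iff, Finset.mem_coe,
      Finset.mem_range, Finset.mem_Icc] at h
    obtain ⟨hk, hl, hm, hm'⟩ := h
    exact mem_indexBelow.2 ⟨hk, by simp only; omega, by simp only; omega⟩
  · rintro ⟨k, l, m⟩ - ⟨k', l', m'⟩ - h
    simp only [Prod.mk.injEq] at h
    obtain ⟨rfl, rfl, rfl⟩ := h
    rfl

/-- The inner product with weight `4 / (|x|² + 1)²`. -/
noncomputable def weightForm (u v : E3 → ℝ) : ℝ := ∫ x, 4 / (‖x‖ ^ 2 + 1) ^ 2 * u x * v x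

theorem ararBoul_mem {n : ℕ} {α : ℕ × ℕ × ℤ} (hα : α ∈ indexBelow n) :
    ararBoul α ∈ wmonoSpan n := by
  obtain ⟨k, l, m⟩ := α
  obtain ⟨hk, hl, hm⟩ := mem_indexBelow.1 hα
  exact ararBoul_mem_wmonoSpan hl hm hk

theorem ararBoul_mem_succ {n : ℕ} {α : ℕ × ℕ × ℤ} (hα : α ∈ indexBelow n) :
    ararBoul α ∈ wmonoSpan (α.1 + 1) := by
  obtain ⟨k, l, m⟩ := α
  obtain ⟨hk, hl, hm⟩ := mem_indexBelow.1 hα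
  exact ararBoul_mem_wmonoSpan hl hm (Nat.lt_succ_self _)

theorem weightForm_ararBoul {n : ℕ} {α : ℕ × ℕ × ℤ} (hα : α ∈ indexBelow n) (β : ℕ × ℕ × ℤ) :
    weightForm (ararBoul α) (ararBoul β) = if α = β then 1 else 0 := by
  obtain ⟨k, l, m⟩ := α
  obtain ⟨hk, hl, hm⟩ := mem_indexBelow.1 hα
  exact integral_ararBoul_mul hl hm

theorem weightForm_sum {n p : ℕ} (c : ℕ × ℕ × ℤ → ℝ) {v : E3 → ℝ} (hv : v ∈ wmonoSpan p) :
    weightForm (∑ α ∈ indexBelow n, c α • ararBoul α) v =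
      ∑ α ∈ indexBelow n, c α * weightForm (ararBoul α) v := by
  have e : ∀ x, 4 / (‖x‖ ^ 2 + 1) ^ 2 * (∑ α ∈ indexBelow n, c α • ararBoul α) x * v x =
      ∑ α ∈ indexBelow n, c α * (4 / (‖x‖ ^ 2 + 1) ^ 2 * ararBoul α x * v x) := fun x => by
    rw [Finset.sum_apply, Finset.mul_sum, Finset.sum_mul]
    exact Finset.sum_congr rfl fun α _ => by rw [Pi.smul_apply, smul_eq_mul]; ring
  simp only [weightForm, e]
  rw [integral_finsetSum _ fun α hα =>
    (integrable_weight_mul_mul (ararBoul_mem hα) hv).const_mul (c α)]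
  exact Finset.sum_congr rfl fun α _ => integral_const_mul _ _

theorem weightForm_sum_ararBoul {n p : ℕ} (c : ℕ × ℕ × ℤ → ℝ) {β : ℕ × ℕ × ℤ}
    (hβ : β ∈ indexBelow p) :
    weightForm (∑ α ∈ indexBelow n, c α • ararBoul α) (ararBoul β) =
      if β ∈ indexBelow n then c β else 0 := by
  rw [weightForm_sum c (ararBoul_mem hβ), Finset.sum_congr rfl fun α hα => by
    rw [weightForm_ararBoul hα, mul_ite, mul_one, mul_zero], Finset.sum_ite_eq']

/-- Orthonormality gives linear independence, and the two counts leave no room for anything outside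
the span. -/
theorem exists_eq_sum_ararBoul {n : ℕ} {u : E3 → ℝ} (hu : u ∈ wmonoSpan n) :
    ∃ c : ℕ × ℕ × ℤ → ℝ, u = ∑ α ∈ indexBelow n, c α • ararBoul α := by
  let b : indexBelow n → wmonoSpan n := fun α => ⟨ararBoul α, ararBoul_mem α.2⟩
  have hli : LinearIndependent ℝ b := by
    rw [Fintype.linearIndependent_iff]
    intro g hg β
    let c : ℕ × ℕ × ℤ → ℝ := fun α => if h : α ∈ indexBelow n then g ⟨α, h⟩ else 0
    have h0 : ∑ α ∈ indexBelow n, c α • ararBoul α = 0 := by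
      rw [← Finset.sum_coe_sort]
      have := congrArg (Submodule.subtype (wmonoSpan n)) hg
      rw [map_sum, map_zero] at this
      rw [← this]
      refine Finset.sum_congr rfl fun α _ => ?_
      simp [c, b]
    have h1 := weightForm_sum_ararBoul (n := n) c β.2
    rw [h0, if_pos β.2] at h1
    have h2 : weightForm 0 (ararBoul β) = 0 := by simp [weightForm]
    rw [h2] at h1
    simpa [c] using h1.symm
  have hcard : Fintype.card (indexBelow n) = Module.finrank ℝ (wmonoSpan n) := by
    refine le_antisymm hli.fintype_card_le_finrank ?_
    rw [Fintype.card_coe]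
    exact (finrank_wmonoSpan_le n).trans (le_card_indexBelow n)
  have htop := hli.span_eq_top_of_card_eq_finrank' hcard
  have hmem : (⟨u, hu⟩ : wmonoSpan n) ∈ Submodule.span ℝ (Set.range b) := by
    rw [htop]; exact Submodule.mem_top
  obtain ⟨g, hg⟩ := (Submodule.mem_span_range_iff_exists_fun ℝ).1 hmem
  refine ⟨fun α => if h : α ∈ indexBelow n then g ⟨α, h⟩ else 0, ?_⟩
  rw [← Finset.sum_coe_sort]
  have := congrArg (Submodule.subtype (wmonoSpan n)) hg
  rw [map_sum] at this
  refine this.symm.trans (Finset.sum_congr rfl fun α _ => ?_)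
  simp [b]

/-! ### Orthogonality for the Dirichlet form -/

/-- The eigenvalue `(k + 1/2) (k + 3/2)`. -/
noncomputable def eigenvalue (k : ℕ) : ℝ := ((k : ℝ) + 1 / 2) * (k + 3 / 2)

theorem eigenvalue_pos (k : ℕ) : 0 < eigenvalue k := by unfold eigenvalue; positivity

/-- By Green's formula only the weighted product of L 𝒲_α with 𝒲_β matters. The remainder of L 𝒲_α
after its eigenvalue part expands in levels strictly below α.1 ≤ β.1, and is orthogonal to 𝒲_β. -/
theorem integral_inner_gradient_ararBoul_of_le {n : ℕ} {α β : ℕ × ℕ × ℤ} (hα : α ∈ indexBelow n)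
    (hβ : β ∈ indexBelow n) (h : α.1 ≤ β.1) :
    ∫ x, inner ℝ (∇ (ararBoul α) x) (∇ (ararBoul β) x) =
      if α = β then eigenvalue α.1 else 0 := by
  obtain ⟨w, hw, hw'⟩ := exists_laplacian_eq (ararBoul_mem_succ hα)
  change w - eigenvalue α.1 • ararBoul α ∈ _ at hw
  have e : w = (w - eigenvalue α.1 • ararBoul α) + eigenvalue α.1 • ararBoul α := by abel
  have hwm : w ∈ wmonoSpan (α.1 + 1) := by
    rw [e]
    exact Submodule.add_mem _ (wmonoSpan_mono (Nat.le_succ _) hw)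
      (Submodule.smul_mem _ _ (ararBoul_mem_succ hα))
  rw [integral_inner_gradient_eq (ararBoul_mem hα) (ararBoul_mem hβ) hwm hw']
  have h0 : weightForm (w - eigenvalue α.1 • ararBoul α) (ararBoul β) = 0 := by
    obtain ⟨c, hc⟩ := exists_eq_sum_ararBoul hw
    rw [hc, weightForm_sum_ararBoul c hβ, if_neg]
    obtain ⟨k, l, m⟩ := β
    intro h'
    have := (mem_indexBelow.1 h').1
    exact absurd h (not_le.2 this)
  have i1 := integrable_weight_mul_mul hw (ararBoul_mem hβ)
  have i2 := (integrable_weight_mul_mul (ararBoul_mem hα) (ararBoul_mem hβ)).const_mul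
    (eigenvalue α.1)
  have h1 : ∫ x, 4 / (‖x‖ ^ 2 + 1) ^ 2 * w x * ararBoul β x =
      weightForm (w - eigenvalue α.1 • ararBoul α) (ararBoul β) +
        eigenvalue α.1 * weightForm (ararBoul α) (ararBoul β) := by
    rw [weightForm, weightForm, ← integral_const_mul, ← integral_add i1 i2]
    refine integral_congr_ae (ae_of_all _ fun x => ?_)
    simp only [Pi.sub_apply, Pi.smul_apply, smul_eq_mul]
    ring
  rw [h1, h0, weightForm_ararBoul hα, zero_add, mul_ite, mul_one, mul_zero]

theorem integral_inner_gradient_ararBoul {n : ℕ} {α β : ℕ × ℕ × ℤ} (hα : α ∈ indexBelow n)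
    (hβ : β ∈ indexBelow n) :
    ∫ x, inner ℝ (∇ (ararBoul α) x) (∇ (ararBoul β) x) =
      if α = β then eigenvalue α.1 else 0 := by
  rcases le_total α.1 β.1 with h | h
  · exact integral_inner_gradient_ararBoul_of_le hα hβ h
  · simp only [fun x => real_inner_comm (∇ (ararBoul β) x) (∇ (ararBoul α) x)]
    rw [integral_inner_gradient_ararBoul_of_le hβ hα h]
    by_cases e : α = β
    · rw [if_pos e, if_pos e.symm, e]
    · rw [if_neg e, if_neg (Ne.symm e)]

theorem gradient_sum_ararBoul (n : ℕ) (c : ℕ × ℕ × ℤ → ℝ) (x : E3) :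
    ∇ (∑ α ∈ indexBelow n, c α • ararBoul α) x =
      ∑ α ∈ indexBelow n, c α • ∇ (ararBoul α) x := by
  have hd : ∀ α ∈ indexBelow n, DifferentiableAt ℝ (ararBoul α) x := fun α hα =>
    (contDiff_of_mem_wmonoSpan (ararBoul_mem hα)).differentiable (by simp) x
  have : fderiv ℝ (∑ α ∈ indexBelow n, c α • ararBoul α) x =
      ∑ α ∈ indexBelow n, c α • fderiv ℝ (ararBoul α) x := by
    rw [fderiv_sum fun α hα => (hd α hα).const_smul (c α)]
    exact Finset.sum_congr rfl fun α hα => fderiv_const_smul (hd α hα) (c α)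
  simp only [gradient, this, map_sum, map_smulₛₗ]
  simp

theorem setIntegral_inner_gradient_sum {Ω : Set E3} {G : E3 → E3}
    (hG : MemLp G 2 (volume.restrict Ω)) (n : ℕ) (c : ℕ × ℕ × ℤ → ℝ) :
    ∫ x in Ω, inner ℝ (G x) (∇ (∑ α ∈ indexBelow n, c α • ararBoul α) x) =
      ∑ α ∈ indexBelow n, c α * ∫ x in Ω, inner ℝ (G x) (∇ (ararBoul α) x) := by
  simp only [gradient_sum_ararBoul, inner_sum, inner_smul_right]
  rw [integral_finsetSum _ fun α hα => (integrable_inner_of_memLp hG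
    ((memLp_gradient (ararBoul_mem hα)).mono_measure Measure.restrict_le_self)).const_mul (c α)]
  exact Finset.sum_congr rfl fun α _ => integral_const_mul _ _

theorem integral_inner_gradient_sum {G : E3 → E3} (hG : MemLp G 2) (n : ℕ) (c : ℕ × ℕ × ℤ → ℝ) :
    ∫ x, inner ℝ (G x) (∇ (∑ α ∈ indexBelow n, c α • ararBoul α) x) =
      ∑ α ∈ indexBelow n, c α * ∫ x, inner ℝ (G x) (∇ (ararBoul α) x) := by
  have := setIntegral_inner_gradient_sum (Ω := Set.univ) (G := G) (by simpa using hG) n c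
  simpa only [Measure.restrict_univ] using this

theorem integral_inner_gradient_sum_ararBoul {n : ℕ} (c : ℕ × ℕ × ℤ → ℝ) {β : ℕ × ℕ × ℤ}
    (hβ : β ∈ indexBelow n) :
    ∫ x, inner ℝ (∇ (∑ α ∈ indexBelow n, c α • ararBoul α) x) (∇ (ararBoul β) x) =
      c β * eigenvalue β.1 := by
  simp only [fun x => real_inner_comm (∇ (ararBoul β) x)
    (∇ (∑ α ∈ indexBelow n, c α • ararBoul α) x)]
  rw [integral_inner_gradient_sum (memLp_gradient (ararBoul_mem hβ)),
    Finset.sum_congr rfl fun α hα => by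
      rw [integral_inner_gradient_ararBoul hβ hα, mul_ite, mul_zero], Finset.sum_ite_eq,
    if_pos hβ]

/-! ### The discrete problem -/

theorem truncatedU_eq_sum (Ω : Set E3) (M : E3 → E3) (N : ℕ) :
    truncatedU Ω M N = ∑ α ∈ indexBelow (N + 1),
      ((∫ y in Ω, inner ℝ (M y) (∇ (ararBoul α) y)) / eigenvalue α.1) • ararBoul α := by
  ext x
  rw [Finset.sum_apply, sum_indexBelow, truncatedU]
  refine Finset.sum_congr rfl fun k _ => Finset.sum_congr rfl ?_
  rintro ⟨i, l, m⟩ h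
  obtain ⟨rfl, -⟩ := (mem_indexLevel k i l m).1 h
  simp only [Pi.smul_apply, smul_eq_mul, eigenvalue]
  field_simp
  ring

theorem solvesDiscrete_truncatedU {Ω : Set E3} {M : E3 → E3}
    (hM : MemLp M 2 (volume.restrict Ω)) (N : ℕ) : SolvesDiscrete Ω M N (truncatedU Ω M N) := by
  have hmem : truncatedU Ω M N ∈ wmonoSpan (N + 1) := by
    rw [truncatedU_eq_sum]
    exact Submodule.sum_mem _ fun α hα => Submodule.smul_mem _ _ (ararBoul_mem hα)
  refine ⟨by rwa [spaceH_eq_wmonoSpan], fun v hv => ?_⟩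
  rw [spaceH_eq_wmonoSpan] at hv
  obtain ⟨c, rfl⟩ := exists_eq_sum_ararBoul hv
  rw [integral_inner_gradient_sum (memLp_gradient hmem), setIntegral_inner_gradient_sum hM]
  refine Finset.sum_congr rfl fun β hβ => ?_
  rw [truncatedU_eq_sum, integral_inner_gradient_sum_ararBoul _ hβ,
    div_mul_cancel₀ _ (eigenvalue_pos _).ne']

theorem SolvesDiscrete.unique {Ω : Set E3} {M : E3 → E3} {N : ℕ} {u v : E3 → ℝ}
    (hu : SolvesDiscrete Ω M N u) (hv : SolvesDiscrete Ω M N v) : u = v := by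
  obtain ⟨hu, hu'⟩ := hu
  obtain ⟨hv, hv'⟩ := hv
  rw [spaceH_eq_wmonoSpan] at hu hv hu' hv'
  obtain ⟨c, rfl⟩ := exists_eq_sum_ararBoul hu
  obtain ⟨d, rfl⟩ := exists_eq_sum_ararBoul hv
  refine Finset.sum_congr rfl fun β hβ => ?_
  have h := (hu' _ (ararBoul_mem hβ)).trans (hv' _ (ararBoul_mem hβ)).symm
  rw [integral_inner_gradient_sum_ararBoul _ hβ, integral_inner_gradient_sum_ararBoul _ hβ] at h
  rw [mul_right_cancel₀ (eigenvalue_pos _).ne' h]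

/-- Test with u itself and use M · ∇u ≤ (|M|² + |∇u|²)/2 on Ω; half of ∫ |∇u|² is absorbed on the
left. -/
theorem SolvesDiscrete.integral_norm_gradient_sq_le {Ω : Set E3} {M : E3 → E3}
    (hM : MemLp M 2 (volume.restrict Ω)) {N : ℕ} {u : E3 → ℝ} (hu : SolvesDiscrete Ω M N u) :
    ∫ x, ‖∇ u x‖ ^ 2 ≤ ∫ x in Ω, ‖M x‖ ^ 2 := by
  have hmem : u ∈ wmonoSpan (N + 1) := by rw [← spaceH_eq_wmonoSpan]; exact hu.1
  have hg := memLp_gradient hmem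
  have hgΩ : MemLp (∇ u) 2 (volume.restrict Ω) := hg.mono_measure Measure.restrict_le_self
  have h := hu.2 u hu.1
  simp only [real_inner_self_eq_norm_sq] at h
  have i1 : Integrable (fun x => ‖M x‖ ^ 2) (volume.restrict Ω) := hM.norm.integrable_sq
  have i2 : Integrable (fun x => ‖∇ u x‖ ^ 2) (volume.restrict Ω) := hgΩ.norm.integrable_sq
  have h1 : ∫ x in Ω, inner ℝ (M x) (∇ u x) ≤ ∫ x in Ω, (‖M x‖ ^ 2 + ‖∇ u x‖ ^ 2) / 2 := by
    refine integral_mono (integrable_inner_of_memLp hM hgΩ) ((i1.add i2).div_const 2) fun x => ?_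
    have := real_inner_le_norm (M x) (∇ u x)
    simp only
    nlinarith [sq_nonneg (‖M x‖ - ‖∇ u x‖)]
  rw [integral_div, integral_add i1 i2] at h1
  have h2 : ∫ x in Ω, ‖∇ u x‖ ^ 2 ≤ ∫ x, ‖∇ u x‖ ^ 2 :=
    setIntegral_le_integral hg.norm.integrable_sq (ae_of_all _ fun x => sq_nonneg _)
  linarith

/-- The weak gradient of U - P is G - ∇P almost everywhere, so ((U - P, v)) is the residual of the
discrete equation for P. Existence and uniqueness of the projection are then those of the discrete
solution. -/
theorem IsMagneticPotential.isW10Projection_iff {Ω : Set E3} {M : E3 → E3}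
    (hM : MemLp M 2 (volume.restrict Ω)) {U : E3 → ℝ} (hU : IsMagneticPotential Ω M U) {N : ℕ}
    {P : E3 → ℝ} : IsW10Projection (spaceH N) U P ↔ SolvesDiscrete Ω M N P := by
  obtain ⟨G, hG, hG2⟩ := hU.1.2
  refine and_congr_right fun hP => forall₂_congr fun v hv => ?_
  rw [spaceH_eq_wmonoSpan] at hP hv
  have h1 := (hG.sub (hasWeakGradient_of_contDiff
    (contDiff_of_mem_wmonoSpan hP))).weakGradient_ae_eq
  have h2 := (hasWeakGradient_of_contDiff (contDiff_of_mem_wmonoSpan hv)).weakGradient_ae_eq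
  have h3 : innerW10 (U - P) v = (∫ x in Ω, inner ℝ (M x) (∇ v x)) -
      ∫ x, inner ℝ (∇ P x) (∇ v x) := by
    rw [← hU.integral_inner hM hG hG2 hv, innerW10,
      ← integral_sub (integrable_inner_of_memLp hG2 (memLp_gradient hv))
        (integrable_inner_of_memLp (memLp_gradient hP) (memLp_gradient hv))]
    refine integral_congr_ae ?_
    filter_upwards [h1, h2] with x hx1 hx2
    rw [hx1, hx2, Pi.sub_apply, inner_sub_left]
  rw [h3, sub_eq_zero, eq_comm]

theorem mainTheorem4 (Ω : Set E3) (hΩ : IsOpen Ω) (M : E3 → E3)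
    (hM : MemLp M 2 (volume.restrict Ω)) (N : ℕ) :
    -- the functions of `H_N` are smooth and `H_N ⊆ W¹₀(ℝ³)`
    (∀ v ∈ spaceH N, ContDiff ℝ ∞ v ∧ MemW10 v) ∧
    -- the discrete problem is well posed, and `U_N` is its unique solution
    SolvesDiscrete Ω M N (truncatedU Ω M N) ∧
    (∀ u : E3 → ℝ, SolvesDiscrete Ω M N u → u = truncatedU Ω M N) ∧
    (∫ x, ‖∇ (truncatedU Ω M N) x‖ ^ 2 ≤ ∫ x in Ω, ‖M x‖ ^ 2) ∧
    -- `U_N` is the orthogonal projection on `H_N` of the solution `U` of `ΔU = div(M χ_Ω)`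
    (∀ U : E3 → ℝ, IsMagneticPotential Ω M U →
      IsW10Projection (spaceH N) U (truncatedU Ω M N) ∧
      ∀ P : E3 → ℝ, IsW10Projection (spaceH N) U P → P = truncatedU Ω M N) := by
  have hsol := solvesDiscrete_truncatedU hM N
  refine ⟨fun v hv => ?_, hsol, fun u hu => hu.unique hsol, hsol.integral_norm_gradient_sq_le hM,
    fun U hU => ⟨(hU.isW10Projection_iff hM).2 hsol, fun P hP =>
      ((hU.isW10Projection_iff hM).1 hP).unique hsol⟩⟩
  rw [spaceH_eq_wmonoSpan] at hv
  exact ⟨contDiff_of_mem_wmonoSpan hv, memW10_of_mem_wmonoSpan hv⟩
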